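/- **Theorem (open Jaynes–Cummings identifiability).** Let $T>0$ and $\omega_c,\omega_q,g\in\mathbb R$. On the photon–qubit space $\ell^2(\mathbb N)\otimes\mathbb C^2$, with photon annihilation operator $a$, let $$H=\omega_c a^\dagger a+\tfrac{\omega_q}{2}\sigma_z+g\,(a^\dagger\sigma_-+a\,\sigma_+),\qquad \mathcal D[L]\rho=L\rho L^\dagger-\tfrac12\{L^\dagger L,\rho\},\qquad X=a+a^\dagger ,$$ where $\sigma_z=+1$ on the excited and $-1$ on the ground state of the qubit and $\sigma_-$ maps the excited state to the ground state. Let $\rho_0$ be a density operator all of whose photon-number moments are finite. Assume that $\rho_0\neq|0\rangle\langle 0|\otimes|\mathrm{ground}\rangle\langle\mathrm{ground}|$ and, only in the uncoupled case $g=0$, also that in $\rho_0$ one has $\langle a^\dagger a\rangle\neq 0$ and $\langle\sigma_z\rangle\neq-1$. For $j=1,2$ let $\kappa_j,\gamma_j:[0,T]\to[0,\infty)$ be continuous, and let $\rho_j(t)$, $t\in[0,T]$, be density operators with $\rho_j(0)=\rho_0$ that solve the master equation $$\dot\rho_j(t)=-i[H,\rho_j(t)]+\kappa_j(t)\,\mathcal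 D[a]\rho_j(t)+\gamma_j(t)\,\mathcal D[\sigma_-]\rho_j(t)$$ on $[0,T]$ (as an equation between matrix elements in the basis of photon-number states tensored with the two qubit states, with one-sided derivatives at the endpoints). Suppose that $$\operatorname{tr}(O\rho_1(t))=\operatorname{tr}(O\rho_2(t))\quad\text{for all }t\in[0,T]\text{ and all }O\in\{\sigma_x,\ \sigma_y,\ \sigma_z,\ a^\dagger a,\ X\otimes\sigma_z\}.$$ Then $\gamma_1(t)=\gamma_2(t)$ and $\kappa_1(t)=\kappa_2(t)$ for all $t\in[0,T]$. That is, for the fixed initial state $\rho_0$, the rates $\gamma$ and $\kappa$ on $[0,T]$ are uniquely determined by the time series of the five observables. -/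

import Mathlib

open scoped Kronecker ComplexOrder

noncomputable section

namespace JaynesCummings

/-- Product of possibly infinite matrices. In every product formed below at least one factor has
finitely supported rows and columns, so the sum has finitely many nonzero terms. -/
def opMul {ι : Type*} (A B : Matrix ι ι ℂ) : Matrix ι ι ℂ :=
  Matrix.of fun i j => ∑' k, A i k * B k j

infixl:70 " ⊡ " => opMul

/-- The Fock basis `|n⟩ ⊗ |s⟩` of the photon-qubit space `ℓ²(ℕ) ⊗ ℂ²`: the first component `n` is the
photon number, the second is the qubit level, `0` the excited and `1` the ground state. -/
abbrev Idx : Type := ℕ × Fin 2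

/-- Operators, given by their matrix elements `⟨x|A|y⟩` in the Fock basis. -/
abbrev Op : Type := Matrix Idx Idx ℂ

/-- The annihilation operator of the photon mode, `a|n+1⟩ = √(n+1)|n⟩`. -/
def photonA : Matrix ℕ ℕ ℂ :=
  Matrix.of fun m n => if n = m + 1 then ((Real.sqrt n : ℝ) : ℂ) else 0

def pauliX : Matrix (Fin 2) (Fin 2) ℂ := !![0, 1; 1, 0]

def pauliY : Matrix (Fin 2) (Fin 2) ℂ := !![0, -Complex.I; Complex.I, 0]

def pauliZ : Matrix (Fin 2) (Fin 2) ℂ := !![1, 0; 0, -1]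

/-- The qubit lowering operator `|ground⟩⟨excited|`. -/
def pauliMinus : Matrix (Fin 2) (Fin 2) ℂ := !![0, 0; 1, 0]

/-- `a ⊗ 1`. -/
def opA : Op := photonA ⊗ₖ (1 : Matrix (Fin 2) (Fin 2) ℂ)

/-- `1 ⊗ σ_x`. -/
def sigmaX : Op := (1 : Matrix ℕ ℕ ℂ) ⊗ₖ pauliX

/-- `1 ⊗ σ_y`. -/
def sigmaY : Op := (1 : Matrix ℕ ℕ ℂ) ⊗ₖ pauliY

/-- `1 ⊗ σ_z`. -/
def sigmaZ : Op := (1 : Matrix ℕ ℕ ℂ) ⊗ₖ pauliZ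

/-- `1 ⊗ σ_-`. -/
def sigmaMinus : Op := (1 : Matrix ℕ ℕ ℂ) ⊗ₖ pauliMinus

/-- The photon number operator `a† a`. -/
def opN : Op := opA.conjTranspose ⊡ opA

/-- The cross observable `X ⊗ σ_z`, with `X = a + a†` the photon quadrature. -/
def opXZ : Op := (photonA + photonA.conjTranspose) ⊗ₖ pauliZ

/-- `H = ω_c a† a + (ω_q / 2) σ_z + g (a† σ_- + a σ_+)`. -/
def hamiltonian (ωc ωq g : ℝ) : Op :=
  (ωc : ℂ) • opN + ((ωq : ℂ) / 2) • sigmaZ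
    + (g : ℂ) • (opA.conjTranspose ⊡ sigmaMinus + opA ⊡ sigmaMinus.conjTranspose)

/-- `D[L]ρ = L ρ L† - ½ (L† L ρ + ρ L† L)`. -/
def dissipator (L ρ : Op) : Op :=
  (L ⊡ ρ) ⊡ L.conjTranspose
    - (1 / 2 : ℂ) • ((L.conjTranspose ⊡ L) ⊡ ρ + ρ ⊡ (L.conjTranspose ⊡ L))

/-- `-i [H, ρ] + κ D[a]ρ + γ D[σ_-]ρ`. -/
def lindbladian (ωc ωq g κ γ : ℝ) (ρ : Op) : Op :=
  (-Complex.I) • (hamiltonian ωc ωq g ⊡ ρ - ρ ⊡ hamiltonian ωc ωq g)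
    + (κ : ℂ) • dissipator opA ρ + (γ : ℂ) • dissipator sigmaMinus ρ

/-- Density operators. A matrix is positive semidefinite with diagonal summing to `1` exactly when
it is the matrix of a positive trace class operator of trace `1`. -/
structure IsDensity (ρ : Op) : Prop where
  posSemidef : ρ.PosSemidef
  hasSum_diag : HasSum (fun x => ρ x x) 1

/-- The expectation value `⟨O⟩ = tr (O ρ)`. -/
def expect (O ρ : Op) : ℂ := ∑' x, (O ⊡ ρ) x x

/-- `|0⟩⟨0| ⊗ |ground⟩⟨ground|`. -/
def vacuumGround : Op := Matrix.single (0, 1) (0, 1) 1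

/-- All moments of the photon number distribution `n ↦ ∑ s, ⟨n, s|ρ|n, s⟩` are finite. -/
def FiniteMoments (ρ : Op) : Prop :=
  ∀ k : ℕ, Summable fun x : Idx => (x.1 : ℝ) ^ k * (ρ x x).re

/-- `ρ` is a trajectory of density operators on `[0,T]` that starts at `ρ₀` and solves the master
equation `ρ' = -i [H, ρ] + κ(t) D[a]ρ + γ(t) D[σ_-]ρ`, as an equation between matrix elements in
the Fock basis. -/
structure IsSolution (ωc ωq g T : ℝ) (κ γ : ℝ → ℝ) (ρ₀ : Op) (ρ : ℝ → Op) : Prop where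
  initial : ρ 0 = ρ₀
  density : ∀ t ∈ Set.Icc 0 T, IsDensity (ρ t)
  master : ∀ t ∈ Set.Icc 0 T, ∀ x y : Idx,
    HasDerivWithinAt (fun s => ρ s x y) (lindbladian ωc ωq g (κ t) (γ t) (ρ t) x y)
      (Set.Icc 0 T) t

/-- Admissible dissipation rates on `[0,T]`: continuous and nonnegative. -/
def IsRate (T : ℝ) (r : ℝ → ℝ) : Prop :=
  ContinuousOn r (Set.Icc 0 T) ∧ ∀ t ∈ Set.Icc 0 T, 0 ≤ r t

end JaynesCummings

end

/-! The Hamiltonian conserves the excitation number and both loss channels lower it by one. Hence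
the entries of ρ on the pairs |m, excited⟩, |m+1, ground⟩ obey a closed chain of real equations, a
`Ladder`. Let p be the excited population (`exc`), n the mean photon number (`phot`) and S the
energy current from qubit to photons (`cur`). Summing over blocks gives p' = -S - γp and n' = S -
κn. The observables σ_z and a†a fix p and n, so two trajectories with the same data satisfy (κ-κ')n
= ΔS = -(γ-γ')p (`cur_sub_cur`). It remains to show ΔS = 0. For g = 0 the current is identically
zero and p, n stay positive, which settles that case.

For g ≠ 0, a weighted distance E of the two ladders (`gap`) satisfies a Gronwall inequality with
source controlled by (κ-κ')²n + (γ-γ')²p, which is ΔS²(1/n + 1/p) (`exists_deriv_gap`). The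
difficulty is that n or p may vanish at some t₀. They never vanish together, and when one does,
coherent exchange makes it grow at least like τ², τ = t - t₀ (`quadratic_growth`,
`eventually_growth`). The source is thus of order ΔS²/τ². Adding ΔS²/τ to E contributes -ΔS²/τ² to
the derivative, which absorbs the source (`lyapunov_le`). Gronwall then gives agreement just to the
right of t₀, and continuation gives it on all of [0,T].

The infinite sums are controlled because excitations are only lost: tails at time t are bounded by
tails at time 0 (`block_le_tail`), so finite moments of the initial state give decay faster than any
power, uniformly in time. -/

open Set Filter Topology

namespace JaynesCummings

/-! ### Rapidly decreasing families and termwise differentiation -/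

/-- A family of real functions on `[0,T]` that decreases in its index faster than any power,
uniformly in time. -/
def Rapid (T : ℝ) (f : ℕ → ℝ → ℝ) : Prop :=
  ∀ k : ℕ, ∃ C : ℝ, ∀ t ∈ Icc 0 T, ∀ m : ℕ, ((m : ℝ) + 1) ^ k * |f m t| ≤ C

/-- A sequence of coefficients of at most polynomial growth. -/
def Tempered (c : ℕ → ℝ) : Prop :=
  ∃ (A : ℝ) (j : ℕ), ∀ m : ℕ, |c m| ≤ A * ((m : ℝ) + 1) ^ j

namespace Rapid

variable {T : ℝ} {f h : ℕ → ℝ → ℝ}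

theorem of_abs_le (hf : Rapid T f) (hle : ∀ t ∈ Icc 0 T, ∀ m, |h m t| ≤ |f m t|) :
    Rapid T h := fun k => by
  obtain ⟨C, hC⟩ := hf k
  exact ⟨C, fun t ht m => (mul_le_mul_of_nonneg_left (hle t ht m) (by positivity)).trans (hC t ht m)⟩

theorem add (hf : Rapid T f) (hh : Rapid T h) : Rapid T (fun m t => f m t + h m t) := fun k => by
  obtain ⟨C, hC⟩ := hf k
  obtain ⟨C', hC'⟩ := hh k
  refine ⟨C + C', fun t ht m => ?_⟩
  calc ((m : ℝ) + 1) ^ k * |f m t + h m t|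
      ≤ ((m : ℝ) + 1) ^ k * (|f m t| + |h m t|) := by gcongr; exact abs_add_le _ _
    _ ≤ C + C' := by rw [mul_add]; exact add_le_add (hC t ht m) (hC' t ht m)

theorem neg (hf : Rapid T f) : Rapid T (fun m t => -f m t) :=
  hf.of_abs_le fun t _ m => by rw [abs_neg]

theorem sub (hf : Rapid T f) (hh : Rapid T h) : Rapid T (fun m t => f m t - h m t) := by
  simpa only [sub_eq_add_neg] using hf.add hh.neg

theorem succ (hf : Rapid T f) : Rapid T (fun m t => f (m + 1) t) := fun k => by
  obtain ⟨C, hC⟩ := hf k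
  refine ⟨C, fun t ht m => le_trans ?_ (hC t ht (m + 1))⟩
  gcongr
  linarith

theorem coeff_mul {c : ℕ → ℝ} (hc : Tempered c) (hf : Rapid T f) :
    Rapid T (fun m t => c m * f m t) := fun k => by
  obtain ⟨A, j, hA⟩ := hc
  obtain ⟨C, hC⟩ := hf (k + j)
  have hA0 : 0 ≤ A := by simpa using (abs_nonneg _).trans (hA 0)
  refine ⟨A * C, fun t ht m => ?_⟩
  calc ((m : ℝ) + 1) ^ k * |c m * f m t|
      = |c m| * (((m : ℝ) + 1) ^ k * |f m t|) := by rw [abs_mul]; ring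
    _ ≤ (A * ((m : ℝ) + 1) ^ j) * (((m : ℝ) + 1) ^ k * |f m t|) := by gcongr; exact hA m
    _ = A * (((m : ℝ) + 1) ^ (k + j) * |f m t|) := by rw [pow_add]; ring
    _ ≤ A * C := by gcongr; exact hC t ht m

theorem bounded_mul {r : ℝ → ℝ} {B : ℝ} (hr : ∀ t ∈ Icc 0 T, |r t| ≤ B) (hf : Rapid T f) :
    Rapid T (fun m t => r t * f m t) := fun k => by
  obtain ⟨C, hC⟩ := hf k
  refine ⟨B * C, fun t ht m => ?_⟩
  have hB : 0 ≤ B := (abs_nonneg _).trans (hr t ht)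
  calc ((m : ℝ) + 1) ^ k * |r t * f m t|
      = |r t| * (((m : ℝ) + 1) ^ k * |f m t|) := by rw [abs_mul]; ring
    _ ≤ B * C := mul_le_mul (hr t ht) (hC t ht m) (by positivity) hB

theorem const_mul (a : ℝ) (hf : Rapid T f) : Rapid T (fun m t => a * f m t) :=
  bounded_mul (r := fun _ => a) (fun _ _ => le_rfl) hf

theorem mul (hf : Rapid T f) (hh : Rapid T h) : Rapid T (fun m t => f m t * h m t) := fun k => by
  obtain ⟨C, hC⟩ := hf k
  obtain ⟨C', hC'⟩ := hh 0
  refine ⟨C * C', fun t ht m => ?_⟩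
  have h1 := hC t ht m
  have h2 := hC' t ht m
  rw [pow_zero, one_mul] at h2
  rw [abs_mul, ← mul_assoc]
  exact mul_le_mul h1 h2 (abs_nonneg _) (le_trans (by positivity) h1)

end Rapid

theorem summable_inv_succ_sq : Summable fun m : ℕ => (((m : ℝ) + 1) ^ 2)⁻¹ := by
  have := (summable_nat_add_iff 1).2 (Real.summable_nat_pow_inv.2 (one_lt_two))
  simpa using this

namespace Rapid

variable {T : ℝ} {f : ℕ → ℝ → ℝ}

theorem exists_summable_bound (hf : Rapid T f) :
    ∃ b : ℕ → ℝ, Summable b ∧ ∀ t ∈ Icc 0 T, ∀ m, |f m t| ≤ b m := by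
  obtain ⟨C, hC⟩ := hf 2
  refine ⟨fun m => C * (((m : ℝ) + 1) ^ 2)⁻¹, summable_inv_succ_sq.mul_left C, fun t ht m => ?_⟩
  beta_reduce
  rw [← div_eq_mul_inv, le_div_iff₀ (by positivity), mul_comm]
  exact hC t ht m

theorem summable (hf : Rapid T f) {t : ℝ} (ht : t ∈ Icc 0 T) : Summable fun m => f m t := by
  obtain ⟨b, hb, hle⟩ := hf.exists_summable_bound
  exact Summable.of_norm_bounded hb fun m => hle t ht m

/-- Termwise differentiation of a series on `[0,T]`. -/
theorem hasDerivWithinAt_tsum {f' : ℕ → ℝ → ℝ} (hf : Rapid T f) (hf' : Rapid T f')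
    (hd : ∀ t ∈ Icc 0 T, ∀ m, HasDerivWithinAt (f m) (f' m t) (Icc 0 T) t)
    {t : ℝ} (ht : t ∈ Icc 0 T) :
    HasDerivWithinAt (fun s => ∑' m, f m s) (∑' m, f' m t) (Icc 0 T) t := by
  obtain ⟨b, hb, hle⟩ := hf'.exists_summable_bound
  rw [hasDerivWithinAt_iff_tendsto_slope]
  -- Dominated convergence for the difference quotients: by the mean value inequality they obey the
  -- same summable bound as the derivatives.
  have key : Tendsto (fun s => ∑' m, slope (f m) t s) (𝓝[Icc 0 T \ {t}] t)
      (𝓝 (∑' m, f' m t)) := by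
    refine tendsto_tsum_of_dominated_convergence hb
      (fun m => (hasDerivWithinAt_iff_tendsto_slope.1 (hd t ht m))) ?_
    filter_upwards [self_mem_nhdsWithin] with s hs m
    have h1 := (convex_Icc (0 : ℝ) T).norm_image_sub_le_of_norm_hasDerivWithin_le
      (fun r hr => hd r hr m) (fun r hr => hle r hr m) ht hs.1
    have h2 : 0 < |s - t| := abs_pos.2 (sub_ne_zero.2 hs.2)
    rw [slope_def_field, Real.norm_eq_abs, abs_div, div_le_iff₀ h2]
    exact h1
  refine key.congr' ?_
  filter_upwards [self_mem_nhdsWithin] with s hs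
  simp only [slope_def_field]
  rw [tsum_div_const, (hf.summable hs.1).tsum_sub (hf.summable ht)]

end Rapid

theorem hasSum_succ_sub_self {h : ℕ → ℝ} (hh : Summable h) :
    HasSum (fun m => h (m + 1) - h m) (-h 0) := by
  have h1 := (hasSum_nat_add_iff' (f := h) 1).2 hh.hasSum
  have := h1.sub hh.hasSum
  simpa using this

/-- Cauchy–Schwarz against the summable sequence (m+1)⁻². The price is two powers of m+1, which the
weight in `gap` has to pay for. -/
theorem sq_tsum_le {c : ℕ → ℝ} (hc : Summable c)
    (hc2 : Summable fun m : ℕ => ((m : ℝ) + 1) ^ 2 * c m ^ 2) :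
    (∑' m, c m) ^ 2 ≤
      (∑' m : ℕ, (((m : ℝ) + 1) ^ 2)⁻¹) * ∑' m : ℕ, ((m : ℝ) + 1) ^ 2 * c m ^ 2 := by
  refine le_of_tendsto (hc.hasSum.pow 2) (Eventually.of_forall fun s => ?_)
  calc (∑ m ∈ s, c m) ^ 2 = (∑ m ∈ s, ((m : ℝ) + 1)⁻¹ * (((m : ℝ) + 1) * c m)) ^ 2 := by
        congr 1
        refine Finset.sum_congr rfl fun m _ => ?_
        rw [← mul_assoc, inv_mul_cancel₀ (by positivity), one_mul]
    _ ≤ (∑ m ∈ s, (((m : ℝ) + 1)⁻¹) ^ 2) * ∑ m ∈ s, (((m : ℝ) + 1) * c m) ^ 2 :=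
        Finset.sum_mul_sq_le_sq_mul_sq _ _ _
    _ ≤ _ := by
        simp only [inv_pow, mul_pow]
        refine mul_le_mul (summable_inv_succ_sq.sum_le_tsum _ fun m _ => by positivity)
          (hc2.sum_le_tsum _ fun m _ => by positivity)
          (Finset.sum_nonneg fun m _ => by positivity) (tsum_nonneg fun m => by positivity)

/-! ### Gronwall inequalities -/

/-- A nonnegative function vanishing at `a` with derivative at most `C` times itself vanishes. -/
theorem eq_zero_of_deriv_le_mul {V V' : ℝ → ℝ} {a b C : ℝ} (hc : ContinuousOn V (Icc a b))
    (hd : ∀ t ∈ Ioo a b, HasDerivAt V (V' t) t) (hle : ∀ t ∈ Ioo a b, V' t ≤ C * V t)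
    (h0 : ∀ t ∈ Icc a b, 0 ≤ V t) (ha : V a = 0) : ∀ t ∈ Icc a b, V t = 0 := by
  have hanti : AntitoneOn (fun t => Real.exp (-C * t) * V t) (Icc a b) := by
    refine antitoneOn_of_hasDerivWithinAt_nonpos
      (f' := fun t => Real.exp (-C * t) * (V' t - C * V t)) (convex_Icc a b)
      ((by fun_prop : Continuous fun t : ℝ => Real.exp (-C * t)).continuousOn.mul hc) ?_ ?_
    · intro t ht
      rw [interior_Icc] at ht
      have h1 : HasDerivAt (fun t : ℝ => Real.exp (-C * t)) (Real.exp (-C * t) * (-C)) t := by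
        simpa using ((hasDerivAt_id t).const_mul (-C)).exp
      have := h1.mul (hd t ht)
      exact (this.congr_deriv (by ring)).hasDerivWithinAt
    · intro t ht
      rw [interior_Icc] at ht
      exact mul_nonpos_of_nonneg_of_nonpos (Real.exp_pos _).le (by linarith [hle t ht])
  intro t ht
  have h1 := hanti (left_mem_Icc.2 (ht.1.trans ht.2)) ht ht.1
  simp only [ha, mul_zero] at h1
  exact le_antisymm (nonpos_of_mul_nonpos_right h1 (Real.exp_pos _)) (h0 t ht)

/-- A function with derivative at least `-C` times itself that starts positive stays positive. -/
theorem pos_of_neg_mul_le_deriv {V V' : ℝ → ℝ} {T C : ℝ}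
    (hd : ∀ t ∈ Icc 0 T, HasDerivWithinAt V (V' t) (Icc 0 T) t)
    (hle : ∀ t ∈ Icc 0 T, -C * V t ≤ V' t) (h0 : 0 < V 0) : ∀ t ∈ Icc 0 T, 0 < V t := by
  have hmono : MonotoneOn (fun t => Real.exp (C * t) * V t) (Icc 0 T) := by
    have hder : ∀ t ∈ Icc 0 T, HasDerivWithinAt (fun t => Real.exp (C * t) * V t)
        (Real.exp (C * t) * (V' t + C * V t)) (Icc 0 T) t := fun t ht => by
      have h1 : HasDerivAt (fun t : ℝ => Real.exp (C * t)) (Real.exp (C * t) * C) t := by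
        simpa using ((hasDerivAt_id t).const_mul C).exp
      exact (h1.hasDerivWithinAt.mul (hd t ht)).congr_deriv (by ring)
    refine monotoneOn_of_hasDerivWithinAt_nonneg (convex_Icc 0 T)
      (fun t ht => (hder t ht).continuousWithinAt)
      (fun t ht => (hder t (interior_subset ht)).mono interior_subset) fun t ht => ?_
    exact mul_nonneg (Real.exp_pos _).le (by linarith [hle t (interior_subset ht)])
  intro t ht
  have h1 := hmono (left_mem_Icc.2 (ht.1.trans ht.2)) ht ht.1
  simp only [mul_zero, Real.exp_zero, one_mul] at h1
  exact pos_of_mul_pos_right (h0.trans_le h1) (Real.exp_pos _).le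

/-! ### The ladder of excitation blocks -/

/-- The coupling strength `√(m+1)` inside the block with `m + 1` excitations. -/
noncomputable def rung (m : ℕ) : ℝ := Real.sqrt ((m : ℝ) + 1)

/-- The factor `√((m+1)(m+2))` with which photon loss feeds coherences to the next block. -/
noncomputable def feed (m : ℕ) : ℝ := Real.sqrt (((m : ℝ) + 1) * ((m : ℝ) + 2))

theorem rung_sq (m : ℕ) : rung m ^ 2 = (m : ℝ) + 1 := Real.sq_sqrt (by positivity)

theorem feed_eq (m : ℕ) : feed m = rung m * rung (m + 1) := by
  rw [feed, rung, rung, Real.sqrt_mul (by positivity)]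
  push_cast
  congr 2
  ring

theorem rung_nonneg (m : ℕ) : 0 ≤ rung m := Real.sqrt_nonneg _

theorem feed_nonneg (m : ℕ) : 0 ≤ feed m := Real.sqrt_nonneg _

theorem feed_sq (m : ℕ) : feed m ^ 2 = ((m : ℝ) + 1) * ((m : ℝ) + 2) :=
  Real.sq_sqrt (by positivity)

theorem feed_le (m : ℕ) : feed m ≤ (m : ℝ) + 2 :=
  Real.sqrt_le_iff.2 ⟨by positivity, by nlinarith [(Nat.cast_nonneg m : (0 : ℝ) ≤ m)]⟩

theorem rung_le (m : ℕ) : rung m ≤ (m : ℝ) + 1 :=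
  Real.sqrt_le_iff.2 ⟨by positivity, by nlinarith [(Nat.cast_nonneg m : (0 : ℝ) ≤ m)]⟩

namespace Tempered

theorem pow (k : ℕ) : Tempered fun m => ((m : ℝ) + 1) ^ k :=
  ⟨1, k, fun m => by rw [one_mul, abs_of_nonneg (by positivity)]⟩

theorem mul {c d : ℕ → ℝ} (hc : Tempered c) (hd : Tempered d) : Tempered fun m => c m * d m := by
  obtain ⟨A, j, hA⟩ := hc
  obtain ⟨A', j', hA'⟩ := hd
  refine ⟨A * A', j + j', fun m => ?_⟩
  rw [abs_mul, pow_add]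
  calc |c m| * |d m| ≤ (A * ((m : ℝ) + 1) ^ j) * (A' * ((m : ℝ) + 1) ^ j') :=
        mul_le_mul (hA m) (hA' m) (abs_nonneg _) ((abs_nonneg _).trans (hA m))
    _ = _ := by ring

theorem of_le {c : ℕ → ℝ} (A : ℝ) (h : ∀ m : ℕ, |c m| ≤ A * ((m : ℝ) + 1)) : Tempered c :=
  ⟨A, 1, fun m => by simpa using h m⟩

theorem succ : Tempered fun m => (m : ℝ) + 1 :=
  of_le 1 fun m => by rw [abs_of_nonneg (by positivity)]; linarith

theorem add_two : Tempered fun m => (m : ℝ) + 2 :=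
  of_le 2 fun m => by
    rw [abs_of_nonneg (by positivity)]; linarith [(Nat.cast_nonneg m : (0 : ℝ) ≤ m)]

theorem add_half : Tempered fun m => (m : ℝ) + 1 / 2 :=
  of_le 1 fun m => by rw [abs_of_nonneg (by positivity)]; linarith

theorem natCast : Tempered fun m => (m : ℝ) :=
  of_le 1 fun m => by rw [abs_of_nonneg (by positivity)]; linarith

theorem rung : Tempered rung :=
  of_le 1 fun m => by rw [abs_of_nonneg (rung_nonneg m)]; linarith [rung_le m]

theorem feed : Tempered feed :=
  of_le 2 fun m => by
    rw [abs_of_nonneg (feed_nonneg m)]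
    linarith [feed_le m, (Nat.cast_nonneg m : (0 : ℝ) ≤ m)]

end Tempered

/-- The block-diagonal part of a trajectory: in the block with `m + 1` excitations, the excited
population `e m`, the ground state population `q m` and the coherence `x m + i y m`. -/
structure Ladder where
  e : ℕ → ℝ → ℝ
  q : ℕ → ℝ → ℝ
  x : ℕ → ℝ → ℝ
  y : ℕ → ℝ → ℝ

namespace Ladder

/-- The excited state probability. -/
noncomputable def exc (u : Ladder) (t : ℝ) : ℝ := ∑' m, u.e m t

/-- The mean photon number. -/
noncomputable def phot (u : Ladder) (t : ℝ) : ℝ := ∑' m : ℕ, (((m : ℝ) + 1) * u.q m t + m * u.e m t)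

/-- The energy current from the qubit to the photon mode. -/
noncomputable def cur (g : ℝ) (u : Ladder) (t : ℝ) : ℝ := ∑' m, 2 * g * (rung m * u.y m t)

/-- The coherent contribution to the derivative of the current. -/
noncomputable def drift (g D : ℝ) (u : Ladder) (t : ℝ) : ℝ :=
  ∑' m : ℕ, (-(2 * g * D) * (rung m * u.x m t)
    - 2 * g ^ 2 * (((m : ℝ) + 1) * (u.q m t - u.e m t)))

/-- The equations of motion of the block-diagonal part, with detuning `D`. -/
structure IsEvolution (g D T : ℝ) (κ γ : ℝ → ℝ) (u : Ladder) : Prop where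
  deriv_e : ∀ t ∈ Icc 0 T, ∀ m, HasDerivWithinAt (u.e m)
    (-(2 * g * (rung m * u.y m t)) - γ t * u.e m t
      + κ t * (((m : ℝ) + 1) * u.e (m + 1) t - m * u.e m t)) (Icc 0 T) t
  deriv_q : ∀ t ∈ Icc 0 T, ∀ m, HasDerivWithinAt (u.q m)
    (2 * g * (rung m * u.y m t) + γ t * u.e (m + 1) t
      + κ t * (((m : ℝ) + 2) * u.q (m + 1) t - ((m : ℝ) + 1) * u.q m t)) (Icc 0 T) t
  deriv_x : ∀ t ∈ Icc 0 T, ∀ m, HasDerivWithinAt (u.x m)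
    (D * u.y m t - γ t * ((1 / 2) * u.x m t)
      + κ t * (feed m * u.x (m + 1) t - ((m : ℝ) + 1 / 2) * u.x m t)) (Icc 0 T) t
  deriv_y : ∀ t ∈ Icc 0 T, ∀ m, HasDerivWithinAt (u.y m)
    (-D * u.x m t - g * (rung m * (u.q m t - u.e m t)) - γ t * ((1 / 2) * u.y m t)
      + κ t * (feed m * u.y (m + 1) t - ((m : ℝ) + 1 / 2) * u.y m t)) (Icc 0 T) t
  e_nonneg : ∀ t ∈ Icc 0 T, ∀ m, 0 ≤ u.e m t
  q_nonneg : ∀ t ∈ Icc 0 T, ∀ m, 0 ≤ u.q m t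
  coherence : ∀ t ∈ Icc 0 T, ∀ m, u.x m t ^ 2 + u.y m t ^ 2 ≤ u.e m t * u.q m t
  rapid_e : Rapid T u.e
  rapid_q : Rapid T u.q

namespace IsEvolution

variable {g D T : ℝ} {κ γ : ℝ → ℝ} {u : Ladder}

/-- Positivity gives x² ≤ e q ≤ (e + q)², so the coherences inherit the decay of the populations. -/
theorem rapid_x (hu : IsEvolution g D T κ γ u) : Rapid T u.x :=
  (hu.rapid_e.add hu.rapid_q).of_abs_le fun t ht m => by
    have he := hu.e_nonneg t ht m
    have hq := hu.q_nonneg t ht m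
    rw [abs_of_nonneg (add_nonneg he hq)]
    refine abs_le_of_sq_le_sq ?_ (add_nonneg he hq)
    nlinarith [hu.coherence t ht m, sq_nonneg (u.y m t)]

theorem rapid_y (hu : IsEvolution g D T κ γ u) : Rapid T u.y :=
  (hu.rapid_e.add hu.rapid_q).of_abs_le fun t ht m => by
    have he := hu.e_nonneg t ht m
    have hq := hu.q_nonneg t ht m
    rw [abs_of_nonneg (add_nonneg he hq)]
    refine abs_le_of_sq_le_sq ?_ (add_nonneg he hq)
    nlinarith [hu.coherence t ht m, sq_nonneg (u.x m t)]

end IsEvolution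

end Ladder

/-- Rates on `[0,T]` are bounded. -/
theorem IsRate.exists_bound {T : ℝ} {r : ℝ → ℝ} (hr : IsRate T r) :
    ∃ B, 0 ≤ B ∧ (∀ t ∈ Icc 0 T, r t ≤ B) ∧ ∀ t ∈ Icc 0 T, |r t| ≤ B := by
  obtain ⟨B, hB⟩ := isCompact_Icc.exists_bound_of_continuousOn hr.1
  refine ⟨max B 0, le_max_right _ _, fun t ht => ?_, fun t ht => (hB t ht).trans (le_max_left _ _)⟩
  exact (le_abs_self _).trans ((hB t ht).trans (le_max_left _ _))

/-! ### Balance equations for populations and current -/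

namespace Ladder.IsEvolution

variable {g D T : ℝ} {κ γ : ℝ → ℝ} {u : Ladder}

section Rapid

variable (hu : IsEvolution g D T κ γ u)
include hu

theorem rapid_current : Rapid T fun m t => 2 * g * (rung m * u.y m t) :=
  (hu.rapid_y.coeff_mul Tempered.rung).const_mul _

theorem rapid_lossE :
    Rapid T fun m t => ((m : ℝ) + 1) * u.e (m + 1) t - m * u.e m t :=
  (hu.rapid_e.succ.coeff_mul Tempered.succ).sub (hu.rapid_e.coeff_mul Tempered.natCast)

theorem rapid_lossQ :
    Rapid T fun m t => ((m : ℝ) + 2) * u.q (m + 1) t - ((m : ℝ) + 1) * u.q m t :=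
  (hu.rapid_q.succ.coeff_mul Tempered.add_two).sub (hu.rapid_q.coeff_mul Tempered.succ)

theorem rapid_lossX :
    Rapid T fun m t => feed m * u.x (m + 1) t - ((m : ℝ) + 1 / 2) * u.x m t :=
  (hu.rapid_x.succ.coeff_mul Tempered.feed).sub (hu.rapid_x.coeff_mul Tempered.add_half)

theorem rapid_lossY :
    Rapid T fun m t => feed m * u.y (m + 1) t - ((m : ℝ) + 1 / 2) * u.y m t :=
  (hu.rapid_y.succ.coeff_mul Tempered.feed).sub (hu.rapid_y.coeff_mul Tempered.add_half)

variable (hκ : IsRate T κ) (hγ : IsRate T γ)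
include hκ hγ

theorem rapid_deriv_e : Rapid T fun m t => -(2 * g * (rung m * u.y m t)) - γ t * u.e m t
      + κ t * (((m : ℝ) + 1) * u.e (m + 1) t - m * u.e m t) := by
  obtain ⟨Bκ, -, -, hBκ⟩ := hκ.exists_bound
  obtain ⟨Bγ, -, -, hBγ⟩ := hγ.exists_bound
  exact (hu.rapid_current.neg.sub (hu.rapid_e.bounded_mul hBγ)).add (hu.rapid_lossE.bounded_mul hBκ)

theorem rapid_deriv_q : Rapid T fun m t => 2 * g * (rung m * u.y m t) + γ t * u.e (m + 1) t
      + κ t * (((m : ℝ) + 2) * u.q (m + 1) t - ((m : ℝ) + 1) * u.q m t) := by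
  obtain ⟨Bκ, -, -, hBκ⟩ := hκ.exists_bound
  obtain ⟨Bγ, -, -, hBγ⟩ := hγ.exists_bound
  exact (hu.rapid_current.add (hu.rapid_e.succ.bounded_mul hBγ)).add
    (hu.rapid_lossQ.bounded_mul hBκ)

theorem rapid_deriv_x : Rapid T fun m t => D * u.y m t - γ t * ((1 / 2) * u.x m t)
      + κ t * (feed m * u.x (m + 1) t - ((m : ℝ) + 1 / 2) * u.x m t) := by
  obtain ⟨Bκ, -, -, hBκ⟩ := hκ.exists_bound
  obtain ⟨Bγ, -, -, hBγ⟩ := hγ.exists_bound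
  exact ((hu.rapid_y.const_mul D).sub ((hu.rapid_x.const_mul _).bounded_mul hBγ)).add
    (hu.rapid_lossX.bounded_mul hBκ)

theorem rapid_deriv_y : Rapid T fun m t =>
    -D * u.x m t - g * (rung m * (u.q m t - u.e m t)) - γ t * ((1 / 2) * u.y m t)
      + κ t * (feed m * u.y (m + 1) t - ((m : ℝ) + 1 / 2) * u.y m t) := by
  obtain ⟨Bκ, -, -, hBκ⟩ := hκ.exists_bound
  obtain ⟨Bγ, -, -, hBγ⟩ := hγ.exists_bound
  exact (((hu.rapid_x.const_mul (-D)).sub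
    (((hu.rapid_q.sub hu.rapid_e).coeff_mul Tempered.rung).const_mul g)).sub
    ((hu.rapid_y.const_mul _).bounded_mul hBγ)).add (hu.rapid_lossY.bounded_mul hBκ)

/-- Photon loss only moves excited population down the ladder, so its contribution telescopes to
zero. -/
theorem hasDeriv_exc {t : ℝ} (ht : t ∈ Icc 0 T) :
    HasDerivWithinAt u.exc (-u.cur g t - γ t * u.exc t) (Icc 0 T) t := by
  refine (hu.rapid_e.hasDerivWithinAt_tsum (hu.rapid_deriv_e hκ hγ) hu.deriv_e ht).congr_deriv ?_
  have h1 : HasSum (fun m : ℕ => ((m : ℝ) + 1) * u.e (m + 1) t - m * u.e m t) 0 := by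
    simpa using hasSum_succ_sub_self ((hu.rapid_e.coeff_mul Tempered.natCast).summable ht)
  exact (((hu.rapid_current.summable ht).hasSum.neg.sub
    ((hu.rapid_e.summable ht).hasSum.mul_left (γ t))).add (h1.mul_left (κ t))).tsum_eq.trans
    (by simp only [cur, exc]; ring)

/-- Qubit decay carries `e (m + 1)` into `q m`, both with m+1 photons, so it telescopes away. Photon
loss telescopes up to -κ times the photon number. -/
theorem hasDeriv_phot {t : ℝ} (ht : t ∈ Icc 0 T) :
    HasDerivWithinAt u.phot (u.cur g t - κ t * u.phot t) (Icc 0 T) t := by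
  have hrap := (hu.rapid_q.coeff_mul Tempered.succ).add (hu.rapid_e.coeff_mul Tempered.natCast)
  have hrap' := ((hu.rapid_deriv_q hκ hγ).coeff_mul Tempered.succ).add
    ((hu.rapid_deriv_e hκ hγ).coeff_mul Tempered.natCast)
  refine (hrap.hasDerivWithinAt_tsum hrap' (fun s hs m =>
    ((hu.deriv_q s hs m).const_mul _).add ((hu.deriv_e s hs m).const_mul _)) ht).congr_deriv ?_
  -- The three telescoping sequences m e, m(m+1) q and m(m-1) e all vanish at m = 0, so no boundary
  -- term is left.
  have h1 := hasSum_succ_sub_self ((hu.rapid_e.coeff_mul Tempered.natCast).summable ht)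
  have h2 := hasSum_succ_sub_self
    (((hu.rapid_q.coeff_mul Tempered.succ).coeff_mul Tempered.natCast).summable ht)
  have h3 := hasSum_succ_sub_self (h := fun m : ℕ => ((m : ℝ) * (m - 1)) * u.e m t)
    ((hu.rapid_e.coeff_mul (Tempered.natCast.mul (Tempered.of_le 1 fun m => by
      rw [one_mul, abs_le]; constructor <;> linarith [(Nat.cast_nonneg m : (0 : ℝ) ≤ m)]))).summable
        ht)
  refine Eq.trans (tsum_congr fun m => ?_) ((((hu.rapid_current.summable ht).hasSum.add
    (h1.mul_left (γ t))).add ((h2.add h3).mul_left (κ t))).sub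
    ((hrap.summable ht).hasSum.mul_left (κ t))).tsum_eq |>.trans ?_
  · push_cast
    ring
  · simp only [cur, phot]
    push_cast
    ring

/-- Since `rung m * feed m` is (m+1) `rung (m + 1)`, photon loss acts on the weighted coherences as
a telescoping sum plus damping at rate κ/2. The damping of the current therefore closes, and both
rates enter only through it. -/
theorem hasDeriv_cur {t : ℝ} (ht : t ∈ Icc 0 T) :
    HasDerivWithinAt (u.cur g) (u.drift g D t - (γ t + κ t) / 2 * u.cur g t) (Icc 0 T) t := by
  have hrap' := (((hu.rapid_deriv_y hκ hγ).coeff_mul Tempered.rung).const_mul (2 * g))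
  refine (hu.rapid_current.hasDerivWithinAt_tsum hrap' (fun s hs m =>
    ((hu.deriv_y s hs m).const_mul _).const_mul _) ht).congr_deriv ?_
  have h1 := hasSum_succ_sub_self
    ((hu.rapid_y.coeff_mul (Tempered.natCast.mul Tempered.rung)).summable ht)
  have h2 := (((hu.rapid_x.coeff_mul Tempered.rung).const_mul (-(2 * g * D))).sub
    (((hu.rapid_q.sub hu.rapid_e).coeff_mul Tempered.succ).const_mul (2 * g ^ 2))).summable ht
  refine Eq.trans (tsum_congr fun m => ?_) ((h2.hasSum.sub
    ((hu.rapid_current.summable ht).hasSum.mul_left ((γ t + κ t) / 2))).add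
      (h1.mul_left (2 * g * κ t))).tsum_eq |>.trans ?_
  · rw [feed_eq, ← rung_sq]
    have hm : (m : ℝ) = rung m ^ 2 - 1 := by rw [rung_sq]; ring
    push_cast
    rw [hm]
    ring
  · simp only [cur, drift]
    push_cast
    ring

end Rapid

end Ladder.IsEvolution

/-! ### Growth of the populations to the right of a zero -/

theorem Icc_mem_nhdsGT_of_mem_Ico {a b t : ℝ} (ht : t ∈ Ico a b) : Icc a b ∈ 𝓝[>] t :=
  mem_of_superset (Ioo_mem_nhdsGT ht.2) fun _ hs => ⟨ht.1.trans hs.1.le, hs.2.le⟩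

/-- If `P' = S - r P` where `P` and `S` vanish at `t₀` and `S` has positive slope there, then `P`
grows at least quadratically to the right of `t₀`. -/
theorem quadratic_growth {P S r : ℝ → ℝ} {T B σ t₀ : ℝ} (ht₀ : t₀ ∈ Ico 0 T) (hσ : 0 < σ)
    (hP : ∀ t ∈ Icc 0 T, HasDerivWithinAt P (S t - r t * P t) (Icc 0 T) t)
    (hB : 0 ≤ B) (hr : ∀ t ∈ Icc 0 T, r t ≤ B) (hP0 : ∀ t ∈ Icc 0 T, 0 ≤ P t)
    (hPt₀ : P t₀ = 0) (hSt₀ : S t₀ = 0) (hS : HasDerivWithinAt S σ (Icc 0 T) t₀) :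
    ∀ᶠ t in 𝓝[>] t₀, 0 ≤ S t ∧ σ / 8 * (t - t₀) ^ 2 ≤ P t := by
  have hmem := Icc_mem_nhdsGT_of_mem_Ico ht₀
  have hS' : Tendsto (slope S t₀) (𝓝[>] t₀) (𝓝 σ) := by
    have := hasDerivWithinAt_iff_tendsto_slope.1 (hS.mono_of_mem_nhdsWithin hmem)
    rwa [sdiff_singleton_eq_self self_notMem_Ioi] at this
  have hP' : Tendsto (slope P t₀) (𝓝[>] t₀) (𝓝 0) := by
    have := hasDerivWithinAt_iff_tendsto_slope.1
      ((hP t₀ (Ico_subset_Icc_self ht₀)).mono_of_mem_nhdsWithin hmem)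
    rwa [sdiff_singleton_eq_self self_notMem_Ioi, hSt₀, hPt₀, mul_zero, sub_zero] at this
  -- P has slope 0 at t₀, so the loss r P eventually takes at most half of the lower bound σ/2 · (t
  -- - t₀) for S. This leaves P' ≥ σ/4 · (t - t₀), which integrates to σ/8 · (t - t₀)².
  have h1 : ∀ᶠ t in 𝓝[>] t₀, t ∈ Icc 0 T ∧ σ / 2 * (t - t₀) ≤ S t ∧
      B * P t ≤ σ / 4 * (t - t₀) := by
    have hε : 0 < σ / (4 * (B + 1)) := by positivity
    filter_upwards [hmem, hS'.eventually (lt_mem_nhds (half_lt_self hσ)),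
      hP'.eventually (gt_mem_nhds hε), self_mem_nhdsWithin] with t ht hs hp htt
    have htt' : 0 < t - t₀ := sub_pos.2 htt
    rw [slope_def_field, hSt₀, sub_zero, lt_div_iff₀ htt'] at hs
    rw [slope_def_field, hPt₀, sub_zero, div_lt_iff₀ htt', div_mul_eq_mul_div,
      lt_div_iff₀ (by positivity)] at hp
    refine ⟨ht, hs.le, ?_⟩
    linarith [hP0 t ht]
  obtain ⟨t₁, ht₁, hsub⟩ := mem_nhdsGT_iff_exists_Ioc_subset.1 h1
  filter_upwards [Ioc_mem_nhdsGT ht₁] with t ht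
  have htt' : 0 < t - t₀ := sub_pos.2 ht.1
  refine ⟨le_trans (by positivity) (hsub ht).2.1, ?_⟩
  have hIcc : ∀ s ∈ Icc t₀ t₁, s ∈ Icc 0 T := fun s hs => by
    rcases eq_or_lt_of_le hs.1 with h | h
    · exact h ▸ Ico_subset_Icc_self ht₀
    · exact (hsub ⟨h, hs.2⟩).1
  have hder : ∀ s ∈ Icc t₀ t₁, HasDerivWithinAt (fun s => P s - σ / 8 * (s - t₀) ^ 2)
      (S s - r s * P s - σ / 4 * (s - t₀)) (Icc t₀ t₁) s := fun s hs => by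
    have h2 := (((hasDerivAt_id s).sub_const t₀).pow 2).const_mul (σ / 8)
    refine (((hP s (hIcc s hs)).mono hIcc).sub h2.hasDerivWithinAt).congr_deriv ?_
    simp
    ring
  have hmono : MonotoneOn (fun s => P s - σ / 8 * (s - t₀) ^ 2) (Icc t₀ t₁) := by
    refine monotoneOn_of_hasDerivWithinAt_nonneg (convex_Icc t₀ t₁)
      (fun s hs => (hder s hs).continuousWithinAt)
      (fun s hs => (hder s (interior_subset hs)).mono interior_subset) fun s hs => ?_
    rw [interior_Icc] at hs
    obtain ⟨hs1, hs2, hs3⟩ := hsub ⟨hs.1, hs.2.le⟩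
    have := mul_le_mul_of_nonneg_right (hr s hs1) (hP0 s hs1)
    linarith
  have h3 := hmono (left_mem_Icc.2 ht₁.le) ⟨ht.1.le, ht.2⟩ ht.1.le
  simp only [hPt₀, sub_self] at h3
  norm_num at h3
  exact h3

namespace Ladder.IsEvolution

variable {g D T : ℝ} {κ γ : ℝ → ℝ} {u : Ladder}

section

variable (hu : IsEvolution g D T κ γ u) {t : ℝ} (ht : t ∈ Icc 0 T)
include hu ht

theorem summable_phot : Summable fun m : ℕ => ((m : ℝ) + 1) * u.q m t + m * u.e m t :=
  ((hu.rapid_q.coeff_mul Tempered.succ).add (hu.rapid_e.coeff_mul Tempered.natCast)).summable ht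

theorem phot_term_nonneg (m : ℕ) : 0 ≤ ((m : ℝ) + 1) * u.q m t + m * u.e m t :=
  add_nonneg (mul_nonneg (by positivity) (hu.q_nonneg t ht m))
    (mul_nonneg (by positivity) (hu.e_nonneg t ht m))

theorem exc_nonneg : 0 ≤ u.exc t := tsum_nonneg (hu.e_nonneg t ht)

theorem phot_nonneg : 0 ≤ u.phot t := tsum_nonneg (hu.phot_term_nonneg ht)

theorem e_eq_zero_of_exc (h : u.exc t = 0) (m : ℕ) : u.e m t = 0 := by
  have h1 := (hu.rapid_e.summable ht).hasSum
  rw [show ∑' m, u.e m t = 0 from h, hasSum_zero_iff_of_nonneg (hu.e_nonneg t ht)] at h1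
  exact congrFun h1 m

/-- Only `m * e m` is forced to vanish: `e 0` is an excited qubit without photons. -/
theorem eq_zero_of_phot (h : u.phot t = 0) (m : ℕ) : u.q m t = 0 ∧ (m : ℝ) * u.e m t = 0 := by
  have h1 := (hu.summable_phot ht).hasSum
  rw [show ∑' m : ℕ, (((m : ℝ) + 1) * u.q m t + m * u.e m t) = 0 from h, hasSum_zero_iff_of_nonneg (hu.phot_term_nonneg ht)] at h1
  have h2 : ((m : ℝ) + 1) * u.q m t + m * u.e m t = 0 := congrFun h1 m
  have h3 := hu.q_nonneg t ht m
  have h4 : 0 ≤ (m : ℝ) * u.e m t := mul_nonneg (by positivity) (hu.e_nonneg t ht m)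
  have h5 : 0 ≤ (m : ℝ) * u.q m t := by positivity
  constructor <;> nlinarith

theorem xy_eq_zero {m : ℕ} (h : u.e m t * u.q m t = 0) : u.x m t = 0 ∧ u.y m t = 0 := by
  have h1 := hu.coherence t ht m
  rw [h] at h1
  constructor <;> refine pow_eq_zero_iff two_ne_zero |>.1 ?_ <;>
    nlinarith [sq_nonneg (u.x m t), sq_nonneg (u.y m t)]

/-- Without excited population positivity kills the coherences, and the current starts to flow back
into the qubit with slope proportional to the photon number. -/
theorem cur_drift_of_exc (h : u.exc t = 0) :
    u.cur g t = 0 ∧ u.drift g D t = -(2 * g ^ 2) * u.phot t := by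
  have he := hu.e_eq_zero_of_exc ht h
  have hxy := fun m => hu.xy_eq_zero ht (m := m) (by rw [he, zero_mul])
  constructor
  · simp [cur, hxy]
  · rw [drift, phot, ← tsum_mul_left]
    refine tsum_congr fun m => ?_
    rw [(hxy m).1, he]
    ring

theorem cur_drift_of_phot (h : u.phot t = 0) :
    u.cur g t = 0 ∧ u.drift g D t = 2 * g ^ 2 * u.exc t := by
  have hq := hu.eq_zero_of_phot ht h
  have hxy := fun m => hu.xy_eq_zero ht (m := m) (by rw [(hq m).1, mul_zero])
  constructor
  · simp [cur, hxy]
  · rw [drift, exc, ← tsum_mul_left]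
    refine tsum_congr fun m => ?_
    rw [(hxy m).1, (hq m).1]
    linear_combination 2 * g ^ 2 * (hq m).2

end

/-- The behaviour of the excited population and the photon number to the right of a given time. -/
theorem eventually_growth (hg : g ≠ 0) (hu : IsEvolution g D T κ γ u) (hκ : IsRate T κ)
    (hγ : IsRate T γ) {t₀ : ℝ} (ht₀ : t₀ ∈ Ico 0 T) (hpos : 0 < u.exc t₀ + u.phot t₀) :
    ∃ c > 0, ∃ C, 0 ≤ C ∧ ∀ᶠ t in 𝓝[>] t₀, c * (t - t₀) ^ 2 ≤ u.exc t ∧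
      c * (t - t₀) ^ 2 ≤ u.phot t ∧ -C ≤ u.cur g t * (1 / u.phot t - 1 / u.exc t) := by
  have hmem := Icc_mem_nhdsGT_of_mem_Ico ht₀
  have ht₀' := Ico_subset_Icc_self ht₀
  obtain ⟨Bκ, hBκ0, hBκ, -⟩ := hκ.exists_bound
  obtain ⟨Bγ, hBγ0, hBγ, -⟩ := hγ.exists_bound
  obtain ⟨M, hM⟩ := isCompact_Icc.exists_bound_of_continuousOn
    (fun t (ht : t ∈ Icc 0 T) => (hu.hasDeriv_cur hκ hγ ht).continuousWithinAt)
  have hM0 : 0 ≤ M := (norm_nonneg _).trans (hM t₀ ht₀')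
  have hone : ∀ᶠ t in 𝓝[>] t₀, t ∈ Ioc t₀ (t₀ + 1) := Ioc_mem_nhdsGT (by linarith)
  -- Within unit time of t₀ a constant lower bound is also a quadratic one, so all three cases take
  -- the same form.
  have hbig : ∀ R : ℝ → ℝ, ContinuousWithinAt R (Icc 0 T) t₀ → 0 < R t₀ →
      ∀ᶠ t in 𝓝[>] t₀, R t₀ / 2 ≤ R t ∧ R t₀ / 2 * (t - t₀) ^ 2 ≤ R t := fun R hR hR0 => by
    filter_upwards [(hR.mono_of_mem_nhdsWithin hmem).eventually (lt_mem_nhds (half_lt_self hR0)),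
      hone] with t h1 h2
    refine ⟨h1.le, le_trans (mul_le_of_le_one_right (half_pos hR0).le ?_) h1.le⟩
    exact pow_le_one₀ (by linarith [h2.1]) (by linarith [h2.2])
  have hdiv : ∀ a d : ℝ, 0 < a → a ≤ d → ∀ s : ℝ, |s| ≤ M → |s / d| ≤ M / a :=
    fun a d ha had s hs => by
      rw [abs_div, abs_of_pos (ha.trans_le had)]
      gcongr
  have hexc := (hu.hasDeriv_exc hκ hγ ht₀').continuousWithinAt
  have hphot := (hu.hasDeriv_phot hκ hγ ht₀').continuousWithinAt
  rcases (hu.exc_nonneg ht₀').eq_or_lt with h0 | h0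
  · have hn : 0 < u.phot t₀ := by linarith
    obtain ⟨hc0, hd0⟩ := hu.cur_drift_of_exc ht₀' h0.symm
    have hσ : 0 < 2 * g ^ 2 * u.phot t₀ := by positivity
    have hq := quadratic_growth (P := u.exc) (S := fun t => -u.cur g t) (r := γ) ht₀ hσ
      (fun t ht => hu.hasDeriv_exc hκ hγ ht) hBγ0 hBγ (fun t ht => hu.exc_nonneg ht) h0.symm
      (by simp [hc0]) ((hu.hasDeriv_cur hκ hγ ht₀').neg.congr_deriv (by rw [hd0, hc0]; ring))
    refine ⟨min (2 * g ^ 2 * u.phot t₀ / 8) (u.phot t₀ / 2), by positivity,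
      M / (u.phot t₀ / 2), by positivity, ?_⟩
    filter_upwards [hq, hbig _ hphot hn, hmem] with t h1 h2 ht
    refine ⟨le_trans (by gcongr; exact min_le_left _ _) h1.2,
      le_trans (by gcongr; exact min_le_right _ _) h2.2, ?_⟩
    have h3 := abs_le.1 (hdiv _ _ (half_pos hn) h2.1 _ (hM t ht))
    -- The current flows towards the empty side, so the quotient with the vanishing denominator has
    -- the favourable sign and needs no bound.
    have h4 : 0 ≤ -u.cur g t / u.exc t := div_nonneg h1.1 (hu.exc_nonneg ht)
    rw [mul_sub, mul_one_div, mul_one_div]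
    rw [neg_div] at h4
    linarith [h3.1]
  rcases (hu.phot_nonneg ht₀').eq_or_lt with h0' | h0'
  · obtain ⟨hc0, hd0⟩ := hu.cur_drift_of_phot ht₀' h0'.symm
    have hσ : 0 < 2 * g ^ 2 * u.exc t₀ := by positivity
    have hq := quadratic_growth (P := u.phot) (S := u.cur g) (r := κ) ht₀ hσ
      (fun t ht => hu.hasDeriv_phot hκ hγ ht) hBκ0 hBκ (fun t ht => hu.phot_nonneg ht) h0'.symm
      hc0 ((hu.hasDeriv_cur hκ hγ ht₀').congr_deriv (by rw [hd0, hc0]; ring))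
    refine ⟨min (2 * g ^ 2 * u.exc t₀ / 8) (u.exc t₀ / 2), by positivity,
      M / (u.exc t₀ / 2), by positivity, ?_⟩
    filter_upwards [hq, hbig _ hexc h0, hmem] with t h1 h2 ht
    refine ⟨le_trans (by gcongr; exact min_le_right _ _) h2.2,
      le_trans (by gcongr; exact min_le_left _ _) h1.2, ?_⟩
    have h3 := abs_le.1 (hdiv _ _ (half_pos h0) h2.1 _ (hM t ht))
    have h4 : 0 ≤ u.cur g t / u.phot t := div_nonneg h1.1 (hu.phot_nonneg ht)
    rw [mul_sub, mul_one_div, mul_one_div]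
    linarith [h3.2]
  · refine ⟨min (u.exc t₀ / 2) (u.phot t₀ / 2), by positivity,
      M / (u.exc t₀ / 2) + M / (u.phot t₀ / 2), by positivity, ?_⟩
    filter_upwards [hbig _ hexc h0, hbig _ hphot h0', hmem] with t h1 h2 ht
    refine ⟨le_trans (by gcongr; exact min_le_left _ _) h1.2,
      le_trans (by gcongr; exact min_le_right _ _) h2.2, ?_⟩
    have h3 := abs_le.1 (hdiv _ _ (half_pos h0) h1.1 _ (hM t ht))
    have h4 := abs_le.1 (hdiv _ _ (half_pos h0') h2.1 _ (hM t ht))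
    rw [mul_sub, mul_one_div, mul_one_div]
    linarith [h3.2, h4.1]

/-- The current cancels in the sum, which therefore decays at most exponentially. -/
theorem exc_add_phot_pos (hu : IsEvolution g D T κ γ u) (hκ : IsRate T κ)
    (hγ : IsRate T γ) (h0 : 0 < u.exc 0 + u.phot 0) :
    ∀ t ∈ Icc 0 T, 0 < u.exc t + u.phot t := by
  obtain ⟨Bκ, hBκ0, hBκ, -⟩ := hκ.exists_bound
  obtain ⟨Bγ, hBγ0, hBγ, -⟩ := hγ.exists_bound
  refine pos_of_neg_mul_le_deriv (C := Bκ + Bγ)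
    (fun t ht => (hu.hasDeriv_exc hκ hγ ht).add (hu.hasDeriv_phot hκ hγ ht)) (fun t ht => ?_) h0
  have h1 := hu.exc_nonneg ht
  have h2 := hu.phot_nonneg ht
  change -(Bκ + Bγ) * (u.exc t + u.phot t) ≤ _
  nlinarith [mul_le_mul_of_nonneg_right (hBκ t ht) h2, mul_le_mul_of_nonneg_right (hBγ t ht) h1,
    mul_nonneg hBκ0 h1, mul_nonneg hBγ0 h2]

end Ladder.IsEvolution

/-! ### Weighted distance between two ladders -/

/-- Young's inequality in the form used for the source terms. -/
theorem two_mul_le_inv_mul_sq_add {ε : ℝ} (hε : 0 < ε) (a b : ℝ) :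
    2 * a * b ≤ ε⁻¹ * a ^ 2 + ε * b ^ 2 := by
  have h : ε⁻¹ * a ^ 2 + ε * b ^ 2 - 2 * a * b = ε⁻¹ * (a - ε * b) ^ 2 := by
    field_simp
    ring
  have h2 : 0 ≤ ε⁻¹ * (a - ε * b) ^ 2 := by positivity
  linarith

/-- One block's contribution to the derivative of the weighted distance. -/
theorem block_energy_le {g D k c M w w' f r ε : ℝ} (hk : 0 ≤ k) (hc : 0 ≤ c) (hM : 0 ≤ M)
    (hw : 0 ≤ w) (hww' : w ≤ w') (hf0 : 0 ≤ f) (hf : f ≤ M + 2) (hε : 0 < ε)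
    (de dq dx dy de' dq' dx' dy' Re Rq Rx Ry : ℝ) :
    w * (2 * de * (-(2 * g * (r * dy)) - c * de + k * ((M + 1) * de' - M * de) + Re)
      + 2 * dq * (2 * g * (r * dy) + c * de' + k * ((M + 2) * dq' - (M + 1) * dq) + Rq)
      + 2 * (2 * dx * (D * dy - c * (1 / 2 * dx) + k * (f * dx' - (M + 1 / 2) * dx) + Rx)
      + 2 * dy * (-D * dx - g * (r * (dq - de)) - c * (1 / 2 * dy)
          + k * (f * dy' - (M + 1 / 2) * dy) + Ry))) ≤
    ((k * (M + 2) + c) * (w' * (de' ^ 2 + dq' ^ 2 + 2 * (dx' ^ 2 + dy' ^ 2)))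
      - (k * (M + 1) + c) * (w * (de ^ 2 + dq ^ 2 + 2 * (dx ^ 2 + dy ^ 2))))
    + (3 * k + 2 * c + ε⁻¹) * (w * (de ^ 2 + dq ^ 2 + 2 * (dx ^ 2 + dy ^ 2)))
    + ε * (w * (Re ^ 2 + Rq ^ 2 + 2 * (Rx ^ 2 + Ry ^ 2))) := by
  set F := de ^ 2 + dq ^ 2 + 2 * (dx ^ 2 + dy ^ 2) with hF
  set F' := de' ^ 2 + dq' ^ 2 + 2 * (dx' ^ 2 + dy' ^ 2) with hF'
  have hF'0 : 0 ≤ F' := by positivity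
  have y1 := two_mul_le_inv_mul_sq_add hε de Re
  have y2 := two_mul_le_inv_mul_sq_add hε dq Rq
  have y3 := two_mul_le_inv_mul_sq_add hε dx Rx
  have y4 := two_mul_le_inv_mul_sq_add hε dy Ry
  have hcross : ∀ a b s : ℝ, 0 ≤ s → s ≤ M + 2 → 2 * s * (a * b) ≤ (M + 2) * (a ^ 2 + b ^ 2) :=
    fun a b s hs hs' => by
      nlinarith [mul_nonneg hs (sq_nonneg (a - b)),
        mul_nonneg (sub_nonneg.2 hs') (add_nonneg (sq_nonneg a) (sq_nonneg b))]
  -- The right side is (M+2) F' - (M+1) F, a telescoping difference before weighting, plus a surplus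
  -- 3 F. In `hcpart` the surplus is 2 F.
  have hkpart : 2 * de * ((M + 1) * de' - M * de) + 2 * dq * ((M + 2) * dq' - (M + 1) * dq)
      + 2 * (2 * dx * (f * dx' - (M + 1 / 2) * dx) + 2 * dy * (f * dy' - (M + 1 / 2) * dy))
      ≤ (M + 2) * F' + (2 - M) * F := by
    have h1 := hcross de de' (M + 1) (by linarith) (by linarith)
    have h2 := hcross dq dq' (M + 2) (by linarith) le_rfl
    have h3 := hcross dx dx' f hf0 hf
    have h4 := hcross dy dy' f hf0 hf
    rw [hF, hF']
    nlinarith [sq_nonneg dq, sq_nonneg dx, sq_nonneg dy]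
  have hcpart : 2 * de * (-de) + 2 * dq * de'
      + 2 * (2 * dx * (-(1 / 2 * dx)) + 2 * dy * (-(1 / 2 * dy))) ≤ F + F' := by
    rw [hF, hF']
    nlinarith [sq_nonneg (dq - de'), sq_nonneg de, sq_nonneg dx, sq_nonneg dy, sq_nonneg dx',
      sq_nonneg dy', sq_nonneg dq']
  -- F is the squared Hilbert–Schmidt norm of a block, the coherence counting twice, and is
  -- invariant under the Hamiltonian flow: all terms in g and D cancel.
  have hin : 2 * de * (-(2 * g * (r * dy)) - c * de + k * ((M + 1) * de' - M * de) + Re)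
      + 2 * dq * (2 * g * (r * dy) + c * de' + k * ((M + 2) * dq' - (M + 1) * dq) + Rq)
      + 2 * (2 * dx * (D * dy - c * (1 / 2 * dx) + k * (f * dx' - (M + 1 / 2) * dx) + Rx)
      + 2 * dy * (-D * dx - g * (r * (dq - de)) - c * (1 / 2 * dy)
          + k * (f * dy' - (M + 1 / 2) * dy) + Ry))
      ≤ k * ((M + 2) * F' + (2 - M) * F) + c * (F + F') + ε⁻¹ * F
        + ε * (Re ^ 2 + Rq ^ 2 + 2 * (Rx ^ 2 + Ry ^ 2)) := by
    have h1 := mul_le_mul_of_nonneg_left hkpart hk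
    have h2 := mul_le_mul_of_nonneg_left hcpart hc
    rw [hF] at h1 h2 ⊢
    linarith
  refine (mul_le_mul_of_nonneg_left hin hw).trans ?_
  -- Raising the weight of F' from w to w' turns the bound into a difference of consecutive terms.
  have h5 : 0 ≤ (k * (M + 2) + c) * ((w' - w) * F') := by
    have := sub_nonneg.2 hww'
    positivity
  linarith

theorem add_sq_le_two_mul (a b : ℝ) : (a + b) ^ 2 ≤ 2 * a ^ 2 + 2 * b ^ 2 := by
  linarith [sq_nonneg (a - b), show (a - b) ^ 2 = 2 * a ^ 2 + 2 * b ^ 2 - (a + b) ^ 2 by ring]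

/-- One block's contribution to the derivative of the weighted distance of two trajectories. -/
theorem block_deriv_le {g D k k' c c' M w w' f r ε K₁ K₂ n₁ n₂ : ℝ} (hk : 0 ≤ k) (hc : 0 ≤ c)
    (hM : 0 ≤ M) (hw : 0 ≤ w) (hww' : w ≤ w') (hf0 : 0 ≤ f) (hf : f ≤ M + 2) (hε : 0 < ε)
    (e q x y e' q' x' y' E Q X Y E' Q' X' Y' : ℝ)
    (hb₁ : w * (((M + 1) * E' - M * E) ^ 2 + ((M + 2) * Q' - (M + 1) * Q) ^ 2
      + 2 * ((f * X' - (M + 1 / 2) * X) ^ 2 + (f * Y' - (M + 1 / 2) * Y) ^ 2)) ≤ K₁ * n₁)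
    (hb₂ : w * (E ^ 2 + E' ^ 2 + 2 * ((1 / 2 * X) ^ 2 + (1 / 2 * Y) ^ 2)) ≤ K₂ * n₂) :
    w * (2 * (e - E) * ((-(2 * g * (r * y)) - c * e + k * ((M + 1) * e' - M * e))
          - (-(2 * g * (r * Y)) - c' * E + k' * ((M + 1) * E' - M * E)))
      + 2 * (q - Q) * ((2 * g * (r * y) + c * e' + k * ((M + 2) * q' - (M + 1) * q))
          - (2 * g * (r * Y) + c' * E' + k' * ((M + 2) * Q' - (M + 1) * Q)))
      + 2 * (2 * (x - X) * ((D * y - c * (1 / 2 * x) + k * (f * x' - (M + 1 / 2) * x))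
          - (D * Y - c' * (1 / 2 * X) + k' * (f * X' - (M + 1 / 2) * X)))
      + 2 * (y - Y) * ((-D * x - g * (r * (q - e)) - c * (1 / 2 * y)
            + k * (f * y' - (M + 1 / 2) * y))
          - (-D * X - g * (r * (Q - E)) - c' * (1 / 2 * Y)
            + k' * (f * Y' - (M + 1 / 2) * Y))))) ≤
    ((k * (M + 2) + c) * (w' * ((e' - E') ^ 2 + (q' - Q') ^ 2
        + 2 * ((x' - X') ^ 2 + (y' - Y') ^ 2)))
      - (k * (M + 1) + c) * (w * ((e - E) ^ 2 + (q - Q) ^ 2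
        + 2 * ((x - X) ^ 2 + (y - Y) ^ 2))))
    + (3 * k + 2 * c + ε⁻¹) * (w * ((e - E) ^ 2 + (q - Q) ^ 2
        + 2 * ((x - X) ^ 2 + (y - Y) ^ 2)))
    + ε * (2 * (k - k') ^ 2 * (K₁ * n₁) + 2 * (c - c') ^ 2 * (K₂ * n₂)) := by
  -- The difference of the trajectories evolves with the rates k, c of the first one; the rate
  -- differences act on the second trajectory as a source.
  have h1 := block_energy_le (g := g) (D := D) (r := r) hk hc hM hw hww' hf0 hf hε
    (e - E) (q - Q) (x - X) (y - Y) (e' - E') (q' - Q') (x' - X') (y' - Y')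
    ((k - k') * ((M + 1) * E' - M * E) + (c - c') * (-E))
    ((k - k') * ((M + 2) * Q' - (M + 1) * Q) + (c - c') * E')
    ((k - k') * (f * X' - (M + 1 / 2) * X) + (c - c') * (-(1 / 2 * X)))
    ((k - k') * (f * Y' - (M + 1 / 2) * Y) + (c - c') * (-(1 / 2 * Y)))
  have h2 : w * (((k - k') * ((M + 1) * E' - M * E) + (c - c') * (-E)) ^ 2
      + ((k - k') * ((M + 2) * Q' - (M + 1) * Q) + (c - c') * E') ^ 2
      + 2 * (((k - k') * (f * X' - (M + 1 / 2) * X) + (c - c') * (-(1 / 2 * X))) ^ 2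
        + ((k - k') * (f * Y' - (M + 1 / 2) * Y) + (c - c') * (-(1 / 2 * Y))) ^ 2)) ≤
      2 * (k - k') ^ 2 * (K₁ * n₁) + 2 * (c - c') ^ 2 * (K₂ * n₂) := by
    refine (mul_le_mul_of_nonneg_left (add_le_add (add_le_add (add_sq_le_two_mul _ _)
      (add_sq_le_two_mul _ _)) (mul_le_mul_of_nonneg_left (add_le_add (add_sq_le_two_mul _ _)
      (add_sq_le_two_mul _ _)) zero_le_two)) hw).trans (le_trans (le_of_eq ?_)
      (add_le_add (mul_le_mul_of_nonneg_left hb₁ (by positivity))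
        (mul_le_mul_of_nonneg_left hb₂ (by positivity))))
    ring
  refine (le_of_eq ?_).trans (h1.trans (add_le_add le_rfl (mul_le_mul_of_nonneg_left h2 hε.le)))
  ring

namespace Ladder

/-- A weighted distance between the block-diagonal parts of two trajectories. -/
noncomputable def gap (u v : Ladder) (t : ℝ) : ℝ :=
  ∑' m : ℕ, ((m : ℝ) + 1) ^ 4 * ((u.e m t - v.e m t) ^ 2 + (u.q m t - v.q m t) ^ 2
    + 2 * ((u.x m t - v.x m t) ^ 2 + (u.y m t - v.y m t) ^ 2))

namespace IsEvolution

variable {g D T : ℝ} {κ γ κ' γ' : ℝ → ℝ} {u v : Ladder}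

/-- Photon loss acts on a state with strength controlled by its photon number. -/
theorem exists_photon_source_bound (hv : IsEvolution g D T κ γ v) :
    ∃ K > 0, ∀ t ∈ Icc 0 T, ∀ m : ℕ, ((m : ℝ) + 1) ^ 4 *
      ((((m : ℝ) + 1) * v.e (m + 1) t - m * v.e m t) ^ 2
        + (((m : ℝ) + 2) * v.q (m + 1) t - ((m : ℝ) + 1) * v.q m t) ^ 2
        + 2 * ((feed m * v.x (m + 1) t - ((m : ℝ) + 1 / 2) * v.x m t) ^ 2
          + (feed m * v.y (m + 1) t - ((m : ℝ) + 1 / 2) * v.y m t) ^ 2)) ≤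
      K * ((((m : ℝ) + 1) * v.q m t + m * v.e m t)
        + ((((m + 1 : ℕ) : ℝ) + 1) * v.q (m + 1) t + ((m + 1 : ℕ) : ℝ) * v.e (m + 1) t)) := by
  obtain ⟨K₁, hK₁⟩ := hv.rapid_e 5
  obtain ⟨K₂, hK₂⟩ := hv.rapid_q 5
  -- In each square one factor is absorbed by rapid decay, leaving a bound linear in the photon
  -- number. Coherences are charged to q, because e carries no photons at m = 0. The term (M+2) q'
  -- collects 2 from its own square and 4 from the two coherence squares.
  refine ⟨6 * (|K₁| + |K₂| + 1), by positivity, fun t ht m => ?_⟩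
  have he := hv.e_nonneg t ht m
  have hq := hv.q_nonneg t ht m
  have he' := hv.e_nonneg t ht (m + 1)
  have hq' := hv.q_nonneg t ht (m + 1)
  have hxy := hv.coherence t ht m
  have hxy' := hv.coherence t ht (m + 1)
  have b1 := hK₁ t ht m
  have b2 := hK₂ t ht m
  have b3 := hK₁ t ht (m + 1)
  have b4 := hK₂ t ht (m + 1)
  rw [abs_of_nonneg (by assumption)] at b1 b2 b3 b4
  have hf := feed_sq m
  have hm : (0 : ℝ) ≤ m := Nat.cast_nonneg m
  push_cast at b3 b4 ⊢
  generalize (m : ℝ) = M at *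
  generalize v.e m t = e at *
  generalize v.q m t = q at *
  generalize v.x m t = x at *
  generalize v.y m t = y at *
  generalize v.e (m + 1) t = e' at *
  generalize v.q (m + 1) t = q' at *
  generalize v.x (m + 1) t = x' at *
  generalize v.y (m + 1) t = y' at *
  generalize feed m = f at *
  set K := |K₁| + |K₂| + 1 with hK
  have hK0 : 0 ≤ K := by positivity
  have k1 : (M + 1) ^ 5 * e ≤ K := by
    linarith [le_abs_self K₁, abs_nonneg K₂]
  have k2 : (M + 1) ^ 5 * q ≤ K := by
    linarith [le_abs_self K₂, abs_nonneg K₁]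
  have k3 : (M + 1) ^ 5 * e' ≤ K := by
    have : (M + 1) ^ 5 * e' ≤ (M + 1 + 1) ^ 5 * e' := by gcongr; linarith
    linarith [le_abs_self K₁, abs_nonneg K₂]
  have k4 : (M + 1) ^ 4 * ((M + 2) * q') ≤ K := by
    have : (M + 1) ^ 4 * ((M + 2) * q') ≤ (M + 1 + 1) ^ 4 * ((M + 2) * q') := by
      gcongr; linarith
    nlinarith [le_abs_self K₂, abs_nonneg K₁]
  have hsub : ∀ a b : ℝ, (a - b) ^ 2 ≤ 2 * a ^ 2 + 2 * b ^ 2 := fun a b => by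
    nlinarith [sq_nonneg (a + b)]
  have t1 : (M + 1) ^ 4 * ((M + 1) * e') ^ 2 ≤ K * ((M + 1) * e') := by
    calc _ = ((M + 1) ^ 5 * e') * ((M + 1) * e') := by ring
      _ ≤ _ := by gcongr
  have t2 : (M + 1) ^ 4 * (M * e) ^ 2 ≤ K * (M * e) := by
    calc (M + 1) ^ 4 * (M * e) ^ 2 = ((M + 1) ^ 4 * M * e) * (M * e) := by ring
      _ ≤ ((M + 1) ^ 4 * (M + 1) * e) * (M * e) := by gcongr; linarith
      _ = ((M + 1) ^ 5 * e) * (M * e) := by ring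
      _ ≤ _ := by gcongr
  have t3 : (M + 1) ^ 4 * ((M + 2) * q') ^ 2 ≤ K * ((M + 2) * q') := by
    calc _ = ((M + 1) ^ 4 * ((M + 2) * q')) * ((M + 2) * q') := by ring
      _ ≤ _ := by gcongr
  have t4 : (M + 1) ^ 4 * ((M + 1) * q) ^ 2 ≤ K * ((M + 1) * q) := by
    calc _ = ((M + 1) ^ 5 * q) * ((M + 1) * q) := by ring
      _ ≤ _ := by gcongr
  have t5 : (M + 1) ^ 4 * (f ^ 2 * (x' ^ 2 + y' ^ 2)) ≤ K * ((M + 2) * q') := by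
    calc (M + 1) ^ 4 * (f ^ 2 * (x' ^ 2 + y' ^ 2))
        ≤ (M + 1) ^ 4 * (f ^ 2 * (e' * q')) := by gcongr
      _ = ((M + 1) ^ 5 * e') * ((M + 2) * q') := by rw [hf]; ring
      _ ≤ _ := by gcongr
  have t6 : (M + 1) ^ 4 * ((M + 1 / 2) ^ 2 * (x ^ 2 + y ^ 2)) ≤ K * ((M + 1) * q) := by
    calc (M + 1) ^ 4 * ((M + 1 / 2) ^ 2 * (x ^ 2 + y ^ 2))
        ≤ (M + 1) ^ 4 * ((M + 1) ^ 2 * (e * q)) := by gcongr; linarith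
      _ = ((M + 1) ^ 5 * e) * ((M + 1) * q) := by ring
      _ ≤ _ := by gcongr
  have hw : 0 ≤ (M + 1) ^ 4 := by positivity
  have s1 := mul_le_mul_of_nonneg_left (hsub ((M + 1) * e') (M * e)) hw
  have s2 := mul_le_mul_of_nonneg_left (hsub ((M + 2) * q') ((M + 1) * q)) hw
  have s3 := mul_le_mul_of_nonneg_left (hsub (f * x') ((M + 1 / 2) * x)) hw
  have s4 := mul_le_mul_of_nonneg_left (hsub (f * y') ((M + 1 / 2) * y)) hw
  have p1 : 0 ≤ K * ((M + 1) * e') := by positivity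
  have p2 : 0 ≤ K * (M * e) := by positivity
  linarith

/-- Qubit decay acts on a state with strength controlled by its excited population. -/
theorem exists_qubit_source_bound (hv : IsEvolution g D T κ γ v) :
    ∃ K > 0, ∀ t ∈ Icc 0 T, ∀ m : ℕ, ((m : ℝ) + 1) ^ 4 *
      (v.e m t ^ 2 + v.e (m + 1) t ^ 2
        + 2 * ((1 / 2 * v.x m t) ^ 2 + (1 / 2 * v.y m t) ^ 2)) ≤
      K * (v.e m t + v.e (m + 1) t) := by
  obtain ⟨K₁, hK₁⟩ := hv.rapid_e 4
  obtain ⟨K₂, hK₂⟩ := hv.rapid_q 4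
  refine ⟨2 * (|K₁| + |K₂| + 1), by positivity, fun t ht m => ?_⟩
  have he := hv.e_nonneg t ht m
  have hq := hv.q_nonneg t ht m
  have he' := hv.e_nonneg t ht (m + 1)
  have hxy := hv.coherence t ht m
  have b1 := hK₁ t ht m
  have b2 := hK₂ t ht m
  have b3 := hK₁ t ht (m + 1)
  rw [abs_of_nonneg (by assumption)] at b1 b2 b3
  have hm : (0 : ℝ) ≤ m := Nat.cast_nonneg m
  push_cast at b3
  generalize (m : ℝ) = M at *
  generalize v.e m t = e at *
  generalize v.q m t = q at *
  generalize v.x m t = x at *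
  generalize v.y m t = y at *
  generalize v.e (m + 1) t = e' at *
  set K := |K₁| + |K₂| + 1 with hK
  have hK0 : 0 ≤ K := by positivity
  have k1 : (M + 1) ^ 4 * e ≤ K := by
    linarith [le_abs_self K₁, abs_nonneg K₂]
  have k2 : (M + 1) ^ 4 * q ≤ K := by
    linarith [le_abs_self K₂, abs_nonneg K₁]
  have k3 : (M + 1) ^ 4 * e' ≤ K := by
    have : (M + 1) ^ 4 * e' ≤ (M + 1 + 1) ^ 4 * e' := by gcongr; linarith
    linarith [le_abs_self K₁, abs_nonneg K₂]
  have t1 := mul_le_mul_of_nonneg_right k1 he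
  have t2 := mul_le_mul_of_nonneg_right k3 he'
  have t3 := mul_le_mul_of_nonneg_right k2 he
  have t4 : (M + 1) ^ 4 * (x ^ 2 + y ^ 2) ≤ (M + 1) ^ 4 * (e * q) := by gcongr
  nlinarith [mul_nonneg hK0 he, mul_nonneg hK0 he']

section

variable (hu : IsEvolution g D T κ γ u) (hv : IsEvolution g D T κ' γ' v)
include hu hv

theorem rapid_gap : Rapid T fun m t => ((m : ℝ) + 1) ^ 4 *
    ((u.e m t - v.e m t) ^ 2 + (u.q m t - v.q m t) ^ 2
      + 2 * ((u.x m t - v.x m t) ^ 2 + (u.y m t - v.y m t) ^ 2)) := by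
  have he := hu.rapid_e.sub hv.rapid_e
  have hq := hu.rapid_q.sub hv.rapid_q
  have hx := hu.rapid_x.sub hv.rapid_x
  have hy := hu.rapid_y.sub hv.rapid_y
  simp only [pow_two (_ - _)]
  exact (((he.mul he).add (hq.mul hq)).add (((hx.mul hx).add (hy.mul hy)).const_mul 2)).coeff_mul
    (Tempered.pow 4)

theorem exists_deriv_gap (hκ : IsRate T κ) (hγ : IsRate T γ) (hκ' : IsRate T κ')
    (hγ' : IsRate T γ') :
    ∃ K > 0, ∃ G' : ℝ → ℝ, ∀ t ∈ Icc 0 T, HasDerivWithinAt (gap u v) (G' t) (Icc 0 T) t ∧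
      ∀ ε > 0, G' t ≤ (3 * κ t + 2 * γ t + ε⁻¹) * gap u v t
        + ε * (K * ((κ t - κ' t) ^ 2 * v.phot t + (γ t - γ' t) ^ 2 * v.exc t)) := by
  obtain ⟨K₁, hK₁, hb₁⟩ := hv.exists_photon_source_bound
  obtain ⟨K₂, hK₂, hb₂⟩ := hv.exists_qubit_source_bound
  have hrap := hu.rapid_gap hv
  have hde := hu.rapid_e.sub hv.rapid_e
  have hdq := hu.rapid_q.sub hv.rapid_q
  have hdx := hu.rapid_x.sub hv.rapid_x
  have hdy := hu.rapid_y.sub hv.rapid_y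
  have hrap' := (((hde.const_mul 2).mul ((hu.rapid_deriv_e hκ hγ).sub (hv.rapid_deriv_e hκ' hγ'))
    |>.add ((hdq.const_mul 2).mul ((hu.rapid_deriv_q hκ hγ).sub (hv.rapid_deriv_q hκ' hγ')))).add
    (((hdx.const_mul 2).mul ((hu.rapid_deriv_x hκ hγ).sub (hv.rapid_deriv_x hκ' hγ'))
    |>.add ((hdy.const_mul 2).mul ((hu.rapid_deriv_y hκ hγ).sub
      (hv.rapid_deriv_y hκ' hγ')))).const_mul 2)).coeff_mul (Tempered.pow 4)
  -- One factor 2 comes from `block_deriv_le`, the other from the shifted series, which are bounded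
  -- by the unshifted ones. The derivative is fixed before ε, which can later depend on K.
  refine ⟨4 * (K₁ + K₂), by positivity, _, fun t ht => ⟨hrap.hasDerivWithinAt_tsum hrap'
    (fun s hs m => ?_) ht, fun ε hε => ?_⟩⟩
  · have h1 := ((hu.deriv_e s hs m).sub (hv.deriv_e s hs m)).pow 2
    have h2 := ((hu.deriv_q s hs m).sub (hv.deriv_q s hs m)).pow 2
    have h3 := ((hu.deriv_x s hs m).sub (hv.deriv_x s hs m)).pow 2
    have h4 := ((hu.deriv_y s hs m).sub (hv.deriv_y s hs m)).pow 2
    refine (((h1.add h2).add ((h3.add h4).const_mul 2)).const_mul (((m : ℝ) + 1) ^ 4)).congr_deriv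
      ?_
    simp only [Pi.sub_apply, Nat.cast_ofNat, Nat.add_one_sub_one, pow_one]
  · have hg := hrap.summable ht
    have htel := hasSum_succ_sub_self (((hrap.coeff_mul (Tempered.succ)).const_mul (κ t)).summable ht
      |>.add ((hrap.const_mul (γ t)).summable ht))
    have hn := hv.summable_phot ht
    have he := hv.rapid_e.summable ht
    have hsrc := (((hn.hasSum.add ((summable_nat_add_iff 1).2 hn).hasSum).mul_left
      (2 * (κ t - κ' t) ^ 2 * K₁)).add ((he.hasSum.add ((summable_nat_add_iff 1).2 he).hasSum).mul_left
      (2 * (γ t - γ' t) ^ 2 * K₂))).mul_left ε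
    have hright := (htel.add (hg.hasSum.mul_left (3 * κ t + 2 * γ t + ε⁻¹))).add hsrc
    refine ((hrap'.summable ht).tsum_le_tsum (fun m => ?_) hright.summable).trans
      (hright.tsum_eq.le.trans ?_)
    · have h1 := block_deriv_le (g := g) (D := D) (M := (m : ℝ)) (w := ((m : ℝ) + 1) ^ 4)
        (w' := (((m + 1 : ℕ) : ℝ) + 1) ^ 4) (r := rung m) (hκ.2 t ht) (hγ.2 t ht)
        (Nat.cast_nonneg m) (by positivity) (by gcongr; simp) (feed_nonneg m) (feed_le m) hε
        (u.e m t) (u.q m t) (u.x m t) (u.y m t)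
        (u.e (m + 1) t) (u.q (m + 1) t) (u.x (m + 1) t) (u.y (m + 1) t)
        (v.e m t) (v.q m t) (v.x m t) (v.y m t)
        (v.e (m + 1) t) (v.q (m + 1) t) (v.x (m + 1) t) (v.y (m + 1) t)
        (k' := κ' t) (c' := γ' t) (hb₁ t ht m) (hb₂ t ht m)
      refine h1.trans (le_of_eq ?_)
      push_cast
      ring
    · have hκ0 := hκ.2 t ht
      have hγ0 := hγ.2 t ht
      have hn1 : ∑' m : ℕ, ((((m + 1 : ℕ) : ℝ) + 1) * v.q (m + 1) t
          + ((m + 1 : ℕ) : ℝ) * v.e (m + 1) t) ≤ v.phot t := by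
        rw [phot, hn.tsum_eq_zero_add]
        exact le_add_of_nonneg_left (hv.phot_term_nonneg ht 0)
      have he1 : ∑' m : ℕ, v.e (m + 1) t ≤ v.exc t := by
        rw [exc, he.tsum_eq_zero_add]
        exact le_add_of_nonneg_left (hv.e_nonneg t ht 0)
      -- The telescoped sum leaves minus (κ + γ) times the zeroth term of the distance, which is
      -- dropped.
      refine add_le_add (add_le_of_nonpos_left (neg_nonpos.2 (by positivity)))
        (mul_le_mul_of_nonneg_left ?_ hε.le)
      have h1 := mul_le_mul_of_nonneg_left (add_le_add (le_refl (v.phot t)) hn1)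
        (by positivity : 0 ≤ 2 * (κ t - κ' t) ^ 2 * K₁)
      have h2 := mul_le_mul_of_nonneg_left (add_le_add (le_refl (v.exc t)) he1)
        (by positivity : 0 ≤ 2 * (γ t - γ' t) ^ 2 * K₂)
      have h3 : 0 ≤ K₂ * ((κ t - κ' t) ^ 2 * v.phot t) :=
        mul_nonneg hK₂.le (mul_nonneg (sq_nonneg _) (hv.phot_nonneg ht))
      have h4 : 0 ≤ K₁ * ((γ t - γ' t) ^ 2 * v.exc t) :=
        mul_nonneg hK₁.le (mul_nonneg (sq_nonneg _) (hv.exc_nonneg ht))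
      refine (add_le_add h1 h2).trans ?_
      linarith

/-- The difference of the coherent drifts is controlled by the weighted distance. -/
theorem exists_drift_bound :
    ∃ K, 0 ≤ K ∧ ∀ t ∈ Icc 0 T, (u.drift g D t - v.drift g D t) ^ 2 ≤ K * gap u v t := by
  set A := (2 * g * D) ^ 2 + 4 * g ^ 4 with hA
  refine ⟨(∑' m : ℕ, (((m : ℝ) + 1) ^ 2)⁻¹) * (4 * A),
    mul_nonneg (tsum_nonneg fun m => by positivity) (by positivity), fun t ht => ?_⟩
  have hrx := (hu.rapid_x.sub hv.rapid_x).coeff_mul Tempered.rung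
  have hrq := ((hu.rapid_q.sub hu.rapid_e).sub (hv.rapid_q.sub hv.rapid_e)).coeff_mul Tempered.succ
  have hr := (hrx.const_mul (-(2 * g * D))).sub (hrq.const_mul (2 * g ^ 2))
  have hdr : ∀ {κ γ : ℝ → ℝ} {w : Ladder}, IsEvolution g D T κ γ w →
      Rapid T fun m t => -(2 * g * D) * (rung m * w.x m t)
        - 2 * g ^ 2 * (((m : ℝ) + 1) * (w.q m t - w.e m t)) := fun hw =>
    ((hw.rapid_x.coeff_mul Tempered.rung).const_mul _).sub
      (((hw.rapid_q.sub hw.rapid_e).coeff_mul Tempered.succ).const_mul _)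
  have h1 : u.drift g D t - v.drift g D t = ∑' m : ℕ,
      (-(2 * g * D) * (rung m * (u.x m t - v.x m t))
        - 2 * g ^ 2 * (((m : ℝ) + 1) * (u.q m t - u.e m t - (v.q m t - v.e m t)))) := by
    rw [drift, drift, ← ((hdr hu).summable ht).tsum_sub ((hdr hv).summable ht)]
    exact tsum_congr fun m => by ring
  have h2 := ((hr.mul hr).coeff_mul (Tempered.pow 2)).summable ht
  simp only [← pow_two] at h2
  rw [h1, mul_assoc (tsum _)]
  -- Cauchy–Schwarz costs (m+1)², and squaring the coefficient m+1 of the population difference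
  -- costs another (m+1)². This is the fourth power in `gap`.
  refine (sq_tsum_le (hr.summable ht) h2).trans (mul_le_mul_of_nonneg_left ?_
    (tsum_nonneg fun m => by positivity))
  rw [gap, ← tsum_mul_left]
  refine h2.tsum_le_tsum (fun m => ?_) (((hu.rapid_gap hv).summable ht).mul_left _)
  have hm : (0 : ℝ) ≤ m := Nat.cast_nonneg m
  have hrg := rung_sq m
  generalize u.x m t - v.x m t = dx
  generalize u.y m t - v.y m t = dy
  have h3 : u.q m t - u.e m t - (v.q m t - v.e m t) = (u.q m t - v.q m t) - (u.e m t - v.e m t) := by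
    ring
  rw [h3]
  generalize u.q m t - v.q m t = dq
  generalize u.e m t - v.e m t = de
  have hsub : ∀ a b : ℝ, (a - b) ^ 2 ≤ 2 * a ^ 2 + 2 * b ^ 2 := fun a b => by
    nlinarith [sq_nonneg (a + b)]
  have h4 : (-(2 * g * D) * (rung m * dx) - 2 * g ^ 2 * (((m : ℝ) + 1) * (dq - de))) ^ 2
      ≤ ((m : ℝ) + 1) ^ 2 * (4 * A * (de ^ 2 + dq ^ 2 + 2 * (dx ^ 2 + dy ^ 2))) := by
    calc _ ≤ 2 * (-(2 * g * D) * (rung m * dx)) ^ 2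
          + 2 * (2 * g ^ 2 * (((m : ℝ) + 1) * (dq - de))) ^ 2 := hsub _ _
      _ = ((m : ℝ) + 1) * (2 * (2 * g * D) ^ 2 * dx ^ 2)
          + ((m : ℝ) + 1) ^ 2 * (8 * g ^ 4 * (dq - de) ^ 2) := by
        rw [← hrg]; ring
      _ ≤ ((m : ℝ) + 1) ^ 2 * (2 * (2 * g * D) ^ 2 * dx ^ 2)
          + ((m : ℝ) + 1) ^ 2 * (8 * g ^ 4 * (2 * dq ^ 2 + 2 * de ^ 2)) := by
        gcongr
        · nlinarith
        · exact hsub _ _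
      _ = ((m : ℝ) + 1) ^ 2 * (2 * (2 * g * D) ^ 2 * dx ^ 2
          + 8 * g ^ 4 * (2 * dq ^ 2 + 2 * de ^ 2)) := by ring
      _ ≤ _ := by
        gcongr
        rw [hA]
        have : 0 ≤ (2 * g * D) ^ 2 := sq_nonneg _
        have : 0 ≤ g ^ 4 := by positivity
        nlinarith [mul_nonneg (sq_nonneg (2 * g * D)) (sq_nonneg dx),
          mul_nonneg (sq_nonneg (2 * g * D)) (sq_nonneg dy),
          mul_nonneg (sq_nonneg (2 * g * D)) (sq_nonneg dq),
          mul_nonneg (sq_nonneg (2 * g * D)) (sq_nonneg de),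
          mul_nonneg this (sq_nonneg dx), mul_nonneg this (sq_nonneg dy)]
  calc _ ≤ ((m : ℝ) + 1) ^ 2 * (((m : ℝ) + 1) ^ 2
        * (4 * A * (de ^ 2 + dq ^ 2 + 2 * (dx ^ 2 + dy ^ 2)))) := by gcongr
    _ = _ := by ring

end

end IsEvolution

end Ladder

/-! ### The Lyapunov function and identifiability for ladders -/

/-- The differential inequality for the squared distance plus the squared current difference
divided by the elapsed time. -/
theorem lyapunov_le {c C K L B₁ B₂ k k' b b' p n τ E G S S' d d' : ℝ} (hc : 0 < c) (hC : 0 ≤ C)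
    (hK : 0 < K) (hL : 0 ≤ L) (hk : 0 ≤ k) (hb : 0 ≤ b) (hk1 : k ≤ B₁) (hb1 : b ≤ B₂)
    (hτ : 0 < τ) (hE0 : 0 ≤ E) (hp : c * τ ^ 2 ≤ p) (hn : c * τ ^ 2 ≤ n)
    (hsign : -C ≤ S' * (1 / n - 1 / p)) (h₁ : S - S' = (k - k') * n)
    (h₂ : S - S' = -((b - b') * p))
    (hG : G ≤ (3 * k + 2 * b + (c / (4 * K))⁻¹) * E
      + c / (4 * K) * (K * ((k - k') ^ 2 * n + (b - b') ^ 2 * p)))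
    (hd : (d - d') ^ 2 ≤ L * E) :
    G + (2 * (S - S') * ((d - (b + k) / 2 * S) - (d' - (b' + k') / 2 * S')) * τ - (S - S') ^ 2)
      / τ ^ 2 ≤ (3 * B₁ + 2 * B₂ + 4 * K / c + 2 * L + C) * (E + (S - S') ^ 2 / τ) := by
  have hp0 : 0 < p := lt_of_lt_of_le (by positivity) hp
  have hn0 : 0 < n := lt_of_lt_of_le (by positivity) hn
  have a₁ : k - k' = (S - S') / n := by rw [eq_div_iff hn0.ne', h₁]
  have a₂ : b - b' = -((S - S') / p) := by
    rw [← neg_div, eq_div_iff hp0.ne', h₂, neg_neg]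
  -- Replacing the rate differences by ΔS/n and -ΔS/p turns the mismatch in damping into ΔS times
  -- the quantity bounded in `hsign`. It enters with a minus sign, so a lower bound suffices.
  have f₁ : (d - (b + k) / 2 * S) - (d' - (b' + k') / 2 * S') = (d - d') - (b + k) / 2 * (S - S')
      - 1 / 2 * ((S - S') * (S' * (1 / n - 1 / p))) := by
    have : (b - b' + (k - k')) * S' = (S - S') * (S' * (1 / n - 1 / p)) := by
      rw [a₁, a₂]; ring
    rw [← this]
    ring
  rw [f₁]
  -- The choice ε = c/(4K) makes the two singular sources use half of ΔS²/τ²; `hyoung` spends the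
  -- other half on the drift.
  have hsource : c / (4 * K) * (K * ((k - k') ^ 2 * n + (b - b') ^ 2 * p))
      ≤ 1 / 2 * ((S - S') ^ 2 / τ ^ 2) := by
    have e₁ : (k - k') ^ 2 * n ≤ (S - S') ^ 2 / (c * τ ^ 2) := by
      have : (k - k') ^ 2 * n = (S - S') ^ 2 / n := by rw [a₁]; field_simp
      rw [this]
      gcongr
    have e₂ : (b - b') ^ 2 * p ≤ (S - S') ^ 2 / (c * τ ^ 2) := by
      have : (b - b') ^ 2 * p = (S - S') ^ 2 / p := by rw [a₂]; field_simp
      rw [this]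
      gcongr
    calc _ ≤ c / (4 * K) * (K * ((S - S') ^ 2 / (c * τ ^ 2) + (S - S') ^ 2 / (c * τ ^ 2))) := by
          gcongr
      _ = _ := by field_simp; ring
  rw [inv_div] at hG
  clear a₁ a₂ f₁ h₁ h₂ hp hn
  generalize S - S' = z at *
  generalize S' * (1 / n - 1 / p) = s at *
  generalize d - d' = X at *
  have hyoung : 2 * (z / τ) * X ≤ 1 / 2 * (z ^ 2 / τ ^ 2) + 2 * (L * E) := by
    have := two_mul_le_inv_mul_sq_add (two_pos) (z / τ) X
    rw [div_pow] at this
    linarith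
  have hsplit : (2 * z * (X - (b + k) / 2 * z - 1 / 2 * (z * s)) * τ - z ^ 2) / τ ^ 2
      = 2 * (z / τ) * X - (b + k) * (z ^ 2 / τ) - s * (z ^ 2 / τ) - z ^ 2 / τ ^ 2 := by
    field_simp
  have hQ : 0 ≤ z ^ 2 / τ := by positivity
  have hB₁ : 0 ≤ B₁ := hk.trans hk1
  have hB₂ : 0 ≤ B₂ := hb.trans hb1
  have r₁ : (3 * k + 2 * b + 4 * K / c) * E ≤ (3 * B₁ + 2 * B₂ + 4 * K / c) * E := by gcongr
  have r₂ : 0 ≤ (3 * B₁ + 2 * B₂ + 4 * K / c + 2 * L) * (z ^ 2 / τ) := by positivity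
  have r₃ := mul_nonneg hC hE0
  have r₄ := mul_nonneg (add_nonneg hb hk) hQ
  have r₅ := mul_le_mul_of_nonneg_right hsign hQ
  rw [hsplit]
  linarith

namespace Ladder.IsEvolution

variable {g D T : ℝ} {κ γ κ' γ' : ℝ → ℝ} {u v : Ladder}

theorem gap_nonneg (u v : Ladder) (t : ℝ) : 0 ≤ gap u v t :=
  tsum_nonneg fun m => by positivity

/-- Two ladders agree at a time when all their entries do. -/
def AgreeAt (u v : Ladder) (t : ℝ) : Prop :=
  ∀ m, u.e m t = v.e m t ∧ u.q m t = v.q m t ∧ u.x m t = v.x m t ∧ u.y m t = v.y m t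

theorem gap_eq_zero_of_agreeAt {t : ℝ} (h : AgreeAt u v t) : gap u v t = 0 := by
  simp [gap, (h _).1, (h _).2.1, (h _).2.2.1, (h _).2.2.2]

theorem cur_eq_of_agreeAt {t : ℝ} (h : AgreeAt u v t) : u.cur g t = v.cur g t := by
  simp [cur, (h _).2.2.2]

theorem agreeAt_of_gap_eq_zero (hu : IsEvolution g D T κ γ u) (hv : IsEvolution g D T κ' γ' v)
    {t : ℝ} (ht : t ∈ Icc 0 T) (h : gap u v t = 0) : AgreeAt u v t := fun m => by
  have h1 := ((hu.rapid_gap hv).summable ht).hasSum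
  rw [← gap, h, hasSum_zero_iff_of_nonneg (fun m => by positivity)] at h1
  have h2 := congrFun h1 m
  simp only [Pi.zero_apply] at h2
  have h3 := (mul_eq_zero.1 h2).resolve_left (by positivity)
  have s1 := sq_nonneg (u.e m t - v.e m t)
  have s2 := sq_nonneg (u.q m t - v.q m t)
  have s3 := sq_nonneg (u.x m t - v.x m t)
  have s4 := sq_nonneg (u.y m t - v.y m t)
  refine ⟨?_, ?_, ?_, ?_⟩ <;> refine sub_eq_zero.1 (pow_eq_zero_iff two_ne_zero |>.1 ?_) <;> linarith

section

variable (hu : IsEvolution g D T κ γ u) (hv : IsEvolution g D T κ' γ' v)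
  (hκ : IsRate T κ) (hγ : IsRate T γ) (hκ' : IsRate T κ') (hγ' : IsRate T γ')
  (hexc : ∀ t ∈ Icc 0 T, u.exc t = v.exc t) (hphot : ∀ t ∈ Icc 0 T, u.phot t = v.phot t)
include hu hv hκ hγ hκ' hγ' hexc hphot

/-- The rates are tied to the current once the observed populations agree. -/
theorem cur_sub_cur (hT : 0 < T) {t : ℝ} (ht : t ∈ Icc 0 T) :
    u.cur g t - v.cur g t = (κ t - κ' t) * v.phot t ∧
      u.cur g t - v.cur g t = -((γ t - γ' t) * v.exc t) := by
  have hud := uniqueDiffOn_Icc hT t ht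
  have h1 := hud.eq_deriv _ (hu.hasDeriv_exc hκ hγ ht)
    ((hv.hasDeriv_exc hκ' hγ' ht).congr hexc (hexc t ht))
  have h2 := hud.eq_deriv _ (hu.hasDeriv_phot hκ hγ ht)
    ((hv.hasDeriv_phot hκ' hγ' ht).congr hphot (hphot t ht))
  rw [hexc t ht] at h1
  rw [hphot t ht] at h2
  constructor <;> linarith

/-- Agreement propagates a little to the right. -/
theorem agreeAt_right (hg : g ≠ 0) (hT : 0 < T) {t₀ : ℝ} (ht₀ : t₀ ∈ Ico 0 T)
    (hpos : 0 < v.exc t₀ + v.phot t₀) (h0 : AgreeAt u v t₀) :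
    ∀ᶠ t in 𝓝[>] t₀, AgreeAt u v t := by
  have ht₀' := Ico_subset_Icc_self ht₀
  obtain ⟨c, hc, C, hC, hgrow⟩ := hv.eventually_growth hg hκ' hγ' ht₀ hpos
  obtain ⟨K, hK, G', hG'⟩ := hu.exists_deriv_gap hv hκ hγ hκ' hγ'
  obtain ⟨L, hL, hdrift⟩ := hu.exists_drift_bound hv
  obtain ⟨Bκ, hBκ0, hBκ, -⟩ := hκ.exists_bound
  obtain ⟨Bγ, hBγ0, hBγ, -⟩ := hγ.exists_bound
  obtain ⟨t₁, ht₁, hsub⟩ := mem_nhdsGT_iff_exists_Ioc_subset.1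
    (hgrow.and (Icc_mem_nhdsGT_of_mem_Ico ht₀))
  have ht₁' : t₀ < t₁ := ht₁
  have hIcc : ∀ t ∈ Icc t₀ t₁, t ∈ Icc 0 T := fun t ht => by
    rcases eq_or_lt_of_le ht.1 with h | h
    · exact h ▸ ht₀'
    · exact (hsub ⟨h, ht.2⟩).2
  set ΔS : ℝ → ℝ := fun t => u.cur g t - v.cur g t with hΔS
  have hΔS0 : ΔS t₀ = 0 := sub_eq_zero.2 (cur_eq_of_agreeAt h0)
  set ΔS' : ℝ → ℝ := fun t => (u.drift g D t - (γ t + κ t) / 2 * u.cur g t)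
    - (v.drift g D t - (γ' t + κ' t) / 2 * v.cur g t) with hΔS'
  have hΔSd : ∀ t ∈ Icc 0 T, HasDerivWithinAt ΔS (ΔS' t) (Icc 0 T) t := fun t ht =>
    (hu.hasDeriv_cur hκ hγ ht).sub (hv.hasDeriv_cur hκ' hγ' ht)
  set V : ℝ → ℝ := fun t => gap u v t + ΔS t ^ 2 / (t - t₀) with hV
  have hV0 : V t₀ = 0 := by simp [hV, gap_eq_zero_of_agreeAt h0]
  have hVnn : ∀ t ∈ Icc t₀ t₁, 0 ≤ V t := fun t ht =>
    add_nonneg (gap_nonneg u v t) (div_nonneg (sq_nonneg _) (sub_nonneg.2 ht.1))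
  have hVd : ∀ t ∈ Ioo t₀ t₁, HasDerivAt V
      (G' t + (2 * ΔS t * ΔS' t * (t - t₀) - ΔS t ^ 2) / (t - t₀) ^ 2) t := fun t ht => by
    have hnhds : Icc 0 T ∈ 𝓝 t := mem_of_superset (Ioo_mem_nhds ht.1 ht.2)
      fun s hs => hIcc s (Ioo_subset_Icc_self hs)
    have htI := hIcc t (Ioo_subset_Icc_self ht)
    have h1 := (hG' t htI).1.hasDerivAt hnhds
    have h2 := ((hΔSd t htI).hasDerivAt hnhds).pow 2
    have h3 := h2.div ((hasDerivAt_id t).sub_const t₀) (sub_pos.2 ht.1).ne'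
    refine (h1.add h3).congr_deriv ?_
    simp
  have hVc : ContinuousOn V (Icc t₀ t₁) := fun t ht => by
    rcases eq_or_lt_of_le ht.1 with h | h
    · subst h
      have h1 : ContinuousWithinAt (gap u v) (Icc t₀ t₁) t₀ :=
        ((hG' t₀ ht₀').1.mono hIcc).continuousWithinAt
      refine h1.add ?_
      rw [← continuousWithinAt_sdiff_self]
      have h2 := (hΔSd t₀ ht₀').mono hIcc
      -- The quotient is the slope of ΔS times ΔS, so it tends to 0, the value that division by zero
      -- assigns at t₀.
      have h3 := (hasDerivWithinAt_iff_tendsto_slope.1 h2).mul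
        (h2.continuousWithinAt.tendsto.mono_left (nhdsWithin_mono t₀ sdiff_subset))
      rw [hΔS0, mul_zero] at h3
      have h4 : Tendsto (fun t => ΔS t ^ 2 / (t - t₀)) (𝓝[Icc t₀ t₁ \ {t₀}] t₀) (𝓝 0) := by
        refine h3.congr fun t => ?_
        rw [slope_def_field, hΔS0]
        ring
      simpa [ContinuousWithinAt] using h4
    · have htI := hIcc t ht
      refine (((hG' t htI).1.mono hIcc).continuousWithinAt).add (ContinuousWithinAt.div
        ((((hΔSd t htI).mono hIcc).continuousWithinAt).pow 2) (by fun_prop) (sub_pos.2 h).ne')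
  have hle : ∀ t ∈ Ioo t₀ t₁,
      G' t + (2 * ΔS t * ΔS' t * (t - t₀) - ΔS t ^ 2) / (t - t₀) ^ 2 ≤
        (3 * Bκ + 2 * Bγ + 4 * K / c + 2 * L + C) * V t := fun t ht => by
    have htI := hIcc t (Ioo_subset_Icc_self ht)
    obtain ⟨⟨g1, g2, g3⟩, -⟩ := hsub (Ioo_subset_Ioc_self ht)
    obtain ⟨d1, d2⟩ := hu.cur_sub_cur hv hκ hγ hκ' hγ' hexc hphot hT htI
    exact lyapunov_le hc hC hK hL (hκ.2 t htI) (hγ.2 t htI) (hBκ t htI) (hBγ t htI)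
      (sub_pos.2 ht.1) (gap_nonneg u v t) g1 g2 g3 d1 d2 ((hG' t htI).2 (c / (4 * K)) (by positivity))
      (hdrift t htI)
  have hzero := eq_zero_of_deriv_le_mul hVc hVd hle hVnn hV0
  filter_upwards [Ioc_mem_nhdsGT ht₁'] with t ht
  have h1 := hzero t (Ioc_subset_Icc_self ht)
  have h2 := gap_nonneg u v t
  have h3 : 0 ≤ ΔS t ^ 2 / (t - t₀) := div_nonneg (sq_nonneg _) (sub_nonneg.2 ht.1.le)
  refine hu.agreeAt_of_gap_eq_zero hv (hIcc t (Ioc_subset_Icc_self ht)) ?_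
  have h4 : gap u v t + ΔS t ^ 2 / (t - t₀) = 0 := h1
  linarith

/-- Continuous induction: the agreement set is the zero set of the continuous function `gap`, hence
closed, and `agreeAt_right` extends it. -/
theorem agreeAt_all (hg : g ≠ 0) (hT : 0 < T) (hpos : 0 < v.exc 0 + v.phot 0)
    (h0 : AgreeAt u v 0) : ∀ t ∈ Icc 0 T, AgreeAt u v t := by
  have hposs := hv.exc_add_phot_pos hκ' hγ' hpos
  obtain ⟨K, hK, G', hG'⟩ := hu.exists_deriv_gap hv hκ hγ hκ' hγ'
  have hcont : ContinuousOn (gap u v) (Icc 0 T) := fun t ht => (hG' t ht).1.continuousWithinAt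
  have hset : {t | AgreeAt u v t} ∩ Icc 0 T = Icc 0 T ∩ gap u v ⁻¹' {0} := by
    ext t
    constructor
    · exact fun h => ⟨h.2, gap_eq_zero_of_agreeAt h.1⟩
    · exact fun h => ⟨hu.agreeAt_of_gap_eq_zero hv h.1 h.2, h.1⟩
  have hclosed : IsClosed ({t | AgreeAt u v t} ∩ Icc 0 T) := by
    rw [hset]
    exact hcont.preimage_isClosed_of_isClosed isClosed_Icc isClosed_singleton
  refine hclosed.Icc_subset_of_forall_exists_gt h0 fun t ht s hs => ?_
  have hev := hu.agreeAt_right hv hκ hγ hκ' hγ' hexc hphot hg hT ht.2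
    (hposs t (Ico_subset_Icc_self ht.2)) ht.1
  exact (hev.and (Ioc_mem_nhdsGT hs)).exists

/-- Identifiability in the coupled case. -/
theorem rates_eq_of_coupled (hg : g ≠ 0) (hT : 0 < T) (hpos : 0 < v.exc 0 + v.phot 0)
    (h0 : AgreeAt u v 0) : ∀ t ∈ Icc 0 T, γ t = γ' t ∧ κ t = κ' t := by
  have hposs := hv.exc_add_phot_pos hκ' hγ' hpos
  have hagree := hu.agreeAt_all hv hκ hγ hκ' hγ' hexc hphot hg hT hpos h0
  have hIco : ∀ t ∈ Ico 0 T, γ t = γ' t ∧ κ t = κ' t := fun t₀ ht₀ => by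
    have hmem := Icc_mem_nhdsGT_of_mem_Ico ht₀
    have ht₀' := Ico_subset_Icc_self ht₀
    obtain ⟨c, hc, C, hC, hgrow⟩ := hv.eventually_growth hg hκ' hγ' ht₀ (hposs t₀ ht₀')
    -- At t₀ a vanishing population may hide one rate. Just to the right both populations are
    -- positive, and continuity carries the equality back to t₀.
    have hev : ∀ᶠ t in 𝓝[>] t₀, γ t = γ' t ∧ κ t = κ' t := by
      filter_upwards [hgrow, hmem, self_mem_nhdsWithin] with t ht htI htt
      obtain ⟨d1, d2⟩ := hu.cur_sub_cur hv hκ hγ hκ' hγ' hexc hphot hT htI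
      have hτ : 0 < t - t₀ := sub_pos.2 htt
      have hp : 0 < v.exc t := lt_of_lt_of_le (by positivity) ht.1
      have hn : 0 < v.phot t := lt_of_lt_of_le (by positivity) ht.2.1
      rw [cur_eq_of_agreeAt (hagree t htI), sub_self] at d1 d2
      exact ⟨sub_eq_zero.1 ((mul_eq_zero.1 (neg_eq_zero.1 d2.symm)).resolve_right hp.ne'),
        sub_eq_zero.1 ((mul_eq_zero.1 d1.symm).resolve_right hn.ne')⟩
    have hlim : ∀ r r' : ℝ → ℝ, IsRate T r → IsRate T r' → (∀ᶠ t in 𝓝[>] t₀, r t = r' t) →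
        r t₀ = r' t₀ := fun r r' hr hr' h =>
      tendsto_nhds_unique_of_eventuallyEq
        ((hr.1 t₀ ht₀').mono_of_mem_nhdsWithin hmem) ((hr'.1 t₀ ht₀').mono_of_mem_nhdsWithin hmem) h
    exact ⟨hlim γ γ' hγ hγ' (hev.mono fun _ h => h.1), hlim κ κ' hκ hκ' (hev.mono fun _ h => h.2)⟩
  -- The endpoint T has nothing to its right in the interval and is reached by continuity from the
  -- left.
  have hclos : closure (Ico 0 T) = Icc 0 T := closure_Ico hT.ne
  have hext : ∀ r r' : ℝ → ℝ, IsRate T r → IsRate T r' → EqOn r r' (Ico 0 T) →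
      EqOn r r' (Icc 0 T) := fun r r' hr hr' h =>
    h.of_subset_closure hr.1 hr'.1 Ico_subset_Icc_self hclos.ge
  exact fun t ht => ⟨hext γ γ' hγ hγ' (fun s hs => (hIco s hs).1) ht,
    hext κ κ' hκ hκ' (fun s hs => (hIco s hs).2) ht⟩

/-- Identifiability in the uncoupled case. -/
theorem rates_eq_of_uncoupled (hg : g = 0) (hT : 0 < T) (hp : 0 < v.exc 0) (hn : 0 < v.phot 0) :
    ∀ t ∈ Icc 0 T, γ t = γ' t ∧ κ t = κ' t := by
  have hcur : ∀ (w : Ladder) (t : ℝ), w.cur g t = 0 := fun w t => by simp [cur, hg]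
  obtain ⟨Bκ, -, hBκ, -⟩ := hκ'.exists_bound
  obtain ⟨Bγ, -, hBγ, -⟩ := hγ'.exists_bound
  have h1 := pos_of_neg_mul_le_deriv (C := Bγ) (fun t ht => hv.hasDeriv_exc hκ' hγ' ht)
    (fun t ht => by
      rw [hcur]
      linarith [mul_le_mul_of_nonneg_right (hBγ t ht) (hv.exc_nonneg ht)]) hp
  have h2 := pos_of_neg_mul_le_deriv (C := Bκ) (fun t ht => hv.hasDeriv_phot hκ' hγ' ht)
    (fun t ht => by
      rw [hcur]
      linarith [mul_le_mul_of_nonneg_right (hBκ t ht) (hv.phot_nonneg ht)]) hn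
  intro t ht
  obtain ⟨d1, d2⟩ := hu.cur_sub_cur hv hκ hγ hκ' hγ' hexc hphot hT ht
  rw [hcur, hcur, sub_self] at d1 d2
  exact ⟨sub_eq_zero.1 ((mul_eq_zero.1 (neg_eq_zero.1 d2.symm)).resolve_right (h1 t ht).ne'),
    sub_eq_zero.1 ((mul_eq_zero.1 d1.symm).resolve_right (h2 t ht).ne')⟩

end

end Ladder.IsEvolution

/-! ### Products of infinite matrices in the Fock basis -/

section Product

variable {ι : Type*} {A B : Matrix ι ι ℂ} {i j : ι}

theorem opMul_eq_sum_left (F : Finset ι) (h : ∀ k ∉ F, A i k = 0) :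
    (A ⊡ B) i j = ∑ k ∈ F, A i k * B k j :=
  tsum_eq_sum fun k hk => by rw [h k hk, zero_mul]

theorem opMul_eq_sum_right (F : Finset ι) (h : ∀ k ∉ F, B k j = 0) :
    (A ⊡ B) i j = ∑ k ∈ F, A i k * B k j :=
  tsum_eq_sum fun k hk => by rw [h k hk, mul_zero]

theorem opMul_eq_left (k : ι) (h : ∀ l, l ≠ k → A i l = 0) : (A ⊡ B) i j = A i k * B k j := by
  rw [opMul_eq_sum_left {k} fun l hl => h l (by simpa using hl), Finset.sum_singleton]

theorem opMul_eq_right (k : ι) (h : ∀ l, l ≠ k → B l j = 0) : (A ⊡ B) i j = A i k * B k j := by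
  rw [opMul_eq_sum_right {k} fun l hl => h l (by simpa using hl), Finset.sum_singleton]

theorem opMul_eq_zero_left (h : ∀ l, A i l = 0) : (A ⊡ B) i j = 0 := by
  rw [opMul_eq_sum_left ∅ fun l _ => h l, Finset.sum_empty]

theorem opMul_eq_zero_right (h : ∀ l, B l j = 0) : (A ⊡ B) i j = 0 := by
  rw [opMul_eq_sum_right ∅ fun l _ => h l, Finset.sum_empty]

theorem diagonal_opMul [DecidableEq ι] (d : ι → ℂ) : (Matrix.diagonal d ⊡ B) i j = d i * B i j := by
  rw [opMul_eq_left i fun l hl => Matrix.diagonal_apply_ne' d hl, Matrix.diagonal_apply_eq]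

theorem opMul_diagonal [DecidableEq ι] (d : ι → ℂ) : (A ⊡ Matrix.diagonal d) i j = A i j * d j := by
  rw [opMul_eq_right j fun l hl => Matrix.diagonal_apply_ne d hl, Matrix.diagonal_apply_eq]

end Product

theorem opA_apply (x y : Idx) :
    opA x y = if y = (x.1 + 1, x.2) then (Real.sqrt ((x.1 : ℝ) + 1) : ℂ) else 0 := by
  obtain ⟨m, s⟩ := x
  obtain ⟨n, r⟩ := y
  simp only [opA, Matrix.kroneckerMap_apply, photonA, Matrix.of_apply, Matrix.one_apply,
    Prod.mk.injEq]
  by_cases h1 : n = m + 1 <;> by_cases h2 : s = r <;> simp [h1, h2, eq_comm]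

theorem opA_opMul (B : Op) (n : ℕ) (s : Fin 2) (y : Idx) :
    (opA ⊡ B) (n, s) y = (Real.sqrt ((n : ℝ) + 1) : ℂ) * B (n + 1, s) y := by
  rw [opMul_eq_left (n + 1, s) fun l hl => by rw [opA_apply, if_neg hl], opA_apply, if_pos rfl]

theorem opMul_opA_conjTranspose (B : Op) (x : Idx) (n : ℕ) (s : Fin 2) :
    (B ⊡ opA.conjTranspose) x (n, s) = B x (n + 1, s) * (Real.sqrt ((n : ℝ) + 1) : ℂ) := by
  rw [opMul_eq_right (n + 1, s) fun l hl => by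
      rw [Matrix.conjTranspose_apply, opA_apply, if_neg hl, star_zero],
    Matrix.conjTranspose_apply, opA_apply, if_pos rfl, Complex.star_def, Complex.conj_ofReal]

theorem opA_conjTranspose_opMul_succ (B : Op) (n : ℕ) (s : Fin 2) (y : Idx) :
    (opA.conjTranspose ⊡ B) (n + 1, s) y = (Real.sqrt ((n : ℝ) + 1) : ℂ) * B (n, s) y := by
  rw [opMul_eq_left (n, s) fun l hl => by
      rw [Matrix.conjTranspose_apply, opA_apply, if_neg, star_zero]
      rintro h
      exact hl (by ext <;> simp_all),
    Matrix.conjTranspose_apply, opA_apply, if_pos rfl, Complex.star_def, Complex.conj_ofReal]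

theorem opA_conjTranspose_opMul_zero (B : Op) (s : Fin 2) (y : Idx) :
    (opA.conjTranspose ⊡ B) (0, s) y = 0 := by
  refine opMul_eq_zero_left fun l => ?_
  rw [Matrix.conjTranspose_apply, opA_apply, if_neg, star_zero]
  simp

theorem opN_eq : opN = Matrix.diagonal fun x : Idx => (x.1 : ℂ) := by
  ext ⟨m, s⟩ y
  rw [opN]
  rcases m with _ | n
  · rw [opA_conjTranspose_opMul_zero]
    by_cases h : (0, s) = y
    · subst h; simp
    · rw [Matrix.diagonal_apply_ne _ h]
  · rw [opA_conjTranspose_opMul_succ, opA_apply]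
    by_cases h : (n + 1, s) = y
    · subst h
      rw [if_pos rfl, Matrix.diagonal_apply_eq, ← Complex.ofReal_mul,
        Real.mul_self_sqrt (by positivity)]
      simp
    · rw [if_neg (Ne.symm h), mul_zero, Matrix.diagonal_apply_ne _ h]

theorem sigmaZ_eq : sigmaZ = Matrix.diagonal fun x : Idx => if x.2 = 0 then (1 : ℂ) else -1 := by
  ext ⟨m, s⟩ ⟨n, r⟩
  simp only [sigmaZ, Matrix.kroneckerMap_apply, Matrix.one_apply, pauliZ, Matrix.diagonal_apply,
    Prod.mk.injEq]
  by_cases h : m = n <;> fin_cases s <;> fin_cases r <;> simp [h]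

theorem sigmaMinus_apply (x y : Idx) :
    sigmaMinus x y = if x.1 = y.1 ∧ x.2 = 1 ∧ y.2 = 0 then 1 else 0 := by
  obtain ⟨m, s⟩ := x
  obtain ⟨n, r⟩ := y
  simp only [sigmaMinus, Matrix.kroneckerMap_apply, Matrix.one_apply, pauliMinus]
  by_cases h : m = n <;> fin_cases s <;> fin_cases r <;> simp [h]

theorem sigmaMinus_opMul_ground (B : Op) (n : ℕ) (y : Idx) :
    (sigmaMinus ⊡ B) (n, 1) y = B (n, 0) y := by
  rw [opMul_eq_left (n, 0) fun l hl => by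
      rw [sigmaMinus_apply, if_neg]
      rintro ⟨h1, -, h2⟩
      exact hl (by ext <;> simp_all),
    sigmaMinus_apply, if_pos ⟨rfl, rfl, rfl⟩, one_mul]

theorem sigmaMinus_opMul_excited (B : Op) (n : ℕ) (y : Idx) :
    (sigmaMinus ⊡ B) (n, 0) y = 0 :=
  opMul_eq_zero_left fun l => by rw [sigmaMinus_apply, if_neg]; simp

theorem opMul_sigmaMinus_conjTranspose_ground (B : Op) (x : Idx) (n : ℕ) :
    (B ⊡ sigmaMinus.conjTranspose) x (n, 1) = B x (n, 0) := by
  rw [opMul_eq_right (n, 0) fun l hl => by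
      rw [Matrix.conjTranspose_apply, sigmaMinus_apply, if_neg, star_zero]
      rintro ⟨h1, -, h2⟩
      exact hl (by ext <;> simp_all),
    Matrix.conjTranspose_apply, sigmaMinus_apply, if_pos ⟨rfl, rfl, rfl⟩, star_one, mul_one]

theorem opMul_sigmaMinus_conjTranspose_excited (B : Op) (x : Idx) (n : ℕ) :
    (B ⊡ sigmaMinus.conjTranspose) x (n, 0) = 0 :=
  opMul_eq_zero_right fun l => by
    rw [Matrix.conjTranspose_apply, sigmaMinus_apply, if_neg, star_zero]; simp

theorem sigmaMinus_conjTranspose_opMul_self : sigmaMinus.conjTranspose ⊡ sigmaMinus =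
    Matrix.diagonal fun x : Idx => if x.2 = 0 then (1 : ℂ) else 0 := by
  ext ⟨m, s⟩ ⟨n, r⟩
  fin_cases s
  · rw [opMul_eq_left (m, 1) fun l hl => by
        rw [Matrix.conjTranspose_apply, sigmaMinus_apply, if_neg, star_zero]
        rintro ⟨h1, h2, -⟩
        exact hl (by ext <;> simp_all)]
    simp only [Matrix.conjTranspose_apply, sigmaMinus_apply, Matrix.diagonal_apply, Prod.mk.injEq]
    by_cases h : m = n <;> fin_cases r <;> simp [h]
  · rw [opMul_eq_zero_left fun l => by
        rw [Matrix.conjTranspose_apply, sigmaMinus_apply, if_neg, star_zero]; simp]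
    simp [Matrix.diagonal_apply]

/-! ### Matrix elements of the generator -/

section Hamiltonian

variable (ωc ωq g : ℝ)

theorem hamiltonian_excited (n : ℕ) (y : Idx) : hamiltonian ωc ωq g (n, 0) y =
    (if y = (n, 0) then (ωc : ℂ) * n + ωq / 2 else 0)
      + if y = (n + 1, 1) then (g : ℂ) * (Real.sqrt ((n : ℝ) + 1) : ℂ) else 0 := by
  obtain ⟨l, r⟩ := y
  have h0 : (opA.conjTranspose ⊡ sigmaMinus) (n, 0) (l, r) = 0 := by
    rcases n with _ | n
    · exact opA_conjTranspose_opMul_zero _ _ _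
    · rw [opA_conjTranspose_opMul_succ, sigmaMinus_apply, if_neg (by simp), mul_zero]
  simp only [hamiltonian, Matrix.add_apply, Matrix.smul_apply, h0, opN_eq, sigmaZ_eq, opA_opMul,
    Matrix.conjTranspose_apply, sigmaMinus_apply, Matrix.diagonal_apply, Prod.mk.injEq, smul_eq_mul]
  fin_cases r
  · by_cases h : l = n
    · simp [h]
    · simp [h, Ne.symm h]
  · by_cases h : l = n + 1 <;> simp [h]

theorem hamiltonian_ground_succ (n : ℕ) (y : Idx) : hamiltonian ωc ωq g (n + 1, 1) y =
    (if y = (n + 1, 1) then (ωc : ℂ) * (n + 1) - ωq / 2 else 0)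
      + if y = (n, 0) then (g : ℂ) * (Real.sqrt ((n : ℝ) + 1) : ℂ) else 0 := by
  obtain ⟨l, r⟩ := y
  simp only [hamiltonian, Matrix.add_apply, Matrix.smul_apply, opN_eq, sigmaZ_eq, opA_opMul,
    opA_conjTranspose_opMul_succ,
    Matrix.conjTranspose_apply, sigmaMinus_apply, Matrix.diagonal_apply, Prod.mk.injEq, smul_eq_mul]
  fin_cases r
  · by_cases h : l = n
    · simp [h]
    · simp [h, Ne.symm h]
  · by_cases h : l = n + 1
    · simp [h]; ring
    · simp [h, Ne.symm h]

theorem hamiltonian_ground_zero (y : Idx) : hamiltonian ωc ωq g (0, 1) y =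
    if y = (0, 1) then -(ωq / 2 : ℂ) else 0 := by
  obtain ⟨l, r⟩ := y
  simp only [hamiltonian, Matrix.add_apply, Matrix.smul_apply, opN_eq, sigmaZ_eq, opA_opMul,
    opA_conjTranspose_opMul_zero,
    Matrix.conjTranspose_apply, sigmaMinus_apply, Matrix.diagonal_apply, Prod.mk.injEq, smul_eq_mul]
  fin_cases r
  · simp
  · by_cases h : l = 0
    · simp [h]
    · simp [h, Ne.symm h]

end Hamiltonian

section Generator

variable (ωc ωq g : ℝ) (ρ : Op)

theorem hamiltonian_symm (x y : Idx) : hamiltonian ωc ωq g x y = hamiltonian ωc ωq g y x := by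
  obtain ⟨m, s⟩ := x
  obtain ⟨n, r⟩ := y
  fin_cases s <;> fin_cases r
  · by_cases h : m = n
    · subst h; rfl
    · simp [hamiltonian_excited, h, Ne.symm h]
  · rcases n with _ | n
    · simp [hamiltonian_excited, hamiltonian_ground_zero]
    · by_cases h : m = n
      · subst h
        simp [hamiltonian_excited, hamiltonian_ground_succ]
      · simp [hamiltonian_excited, hamiltonian_ground_succ, h, Ne.symm h]
  · rcases m with _ | m
    · simp [hamiltonian_excited, hamiltonian_ground_zero]
    · by_cases h : m = n
      · subst h
        simp [hamiltonian_excited, hamiltonian_ground_succ]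
      · simp [hamiltonian_excited, hamiltonian_ground_succ, h, Ne.symm h]
  · by_cases h : m = n
    · subst h; rfl
    · rcases m with _ | m <;> rcases n with _ | n
      · exact absurd rfl h
      · simp [hamiltonian_ground_zero, hamiltonian_ground_succ]
      · simp [hamiltonian_ground_zero, hamiltonian_ground_succ]
      · have h' : m ≠ n := fun h' => h (by rw [h'])
        simp [hamiltonian_ground_succ, h', Ne.symm h']

theorem hamiltonian_opMul_excited (n : ℕ) (y : Idx) :
    (hamiltonian ωc ωq g ⊡ ρ) (n, 0) y =
      ((ωc : ℂ) * n + ωq / 2) * ρ (n, 0) y + g * rung n * ρ (n + 1, 1) y := by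
  rw [opMul_eq_sum_left {(n, 0), (n + 1, 1)} fun k hk => by
      rw [Finset.mem_insert, Finset.mem_singleton, not_or] at hk
      rw [hamiltonian_excited, if_neg hk.1, if_neg hk.2, add_zero],
    Finset.sum_pair (by simp)]
  simp [hamiltonian_excited, rung]

theorem hamiltonian_opMul_ground_succ (n : ℕ) (y : Idx) :
    (hamiltonian ωc ωq g ⊡ ρ) (n + 1, 1) y =
      ((ωc : ℂ) * (n + 1) - ωq / 2) * ρ (n + 1, 1) y + g * rung n * ρ (n, 0) y := by
  rw [opMul_eq_sum_left {(n + 1, 1), (n, 0)} fun k hk => by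
      rw [Finset.mem_insert, Finset.mem_singleton, not_or] at hk
      rw [hamiltonian_ground_succ, if_neg hk.1, if_neg hk.2, add_zero],
    Finset.sum_pair (by simp)]
  simp [hamiltonian_ground_succ, rung]

theorem hamiltonian_opMul_ground_zero (y : Idx) :
    (hamiltonian ωc ωq g ⊡ ρ) (0, 1) y = -(ωq / 2 : ℂ) * ρ (0, 1) y := by
  rw [opMul_eq_left (0, 1) fun k hk => by rw [hamiltonian_ground_zero, if_neg hk],
    hamiltonian_ground_zero, if_pos rfl]

/-- The matrix of H is symmetric, so right products reduce to the left products already computed. -/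
theorem opMul_hamiltonian_eq (x y : Idx) :
    (ρ ⊡ hamiltonian ωc ωq g) x y = (hamiltonian ωc ωq g ⊡ ρ.transpose) y x :=
  tsum_congr fun k => by rw [Matrix.transpose_apply, hamiltonian_symm, mul_comm]

theorem dissipator_opA (m n : ℕ) (s r : Fin 2) : dissipator opA ρ (m, s) (n, r) =
    rung m * rung n * ρ (m + 1, s) (n + 1, r) - (m + n) / 2 * ρ (m, s) (n, r) := by
  have h : opA.conjTranspose ⊡ opA = opN := rfl
  simp only [dissipator, Matrix.sub_apply, Matrix.add_apply, Matrix.smul_apply, smul_eq_mul, h,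
    opN_eq, diagonal_opMul, opMul_diagonal, opMul_opA_conjTranspose, opA_opMul, rung]
  ring

theorem dissipator_sigmaMinus_excited (m n : ℕ) :
    dissipator sigmaMinus ρ (m, 0) (n, 0) = -ρ (m, 0) (n, 0) := by
  simp only [dissipator, Matrix.sub_apply, Matrix.add_apply, Matrix.smul_apply, smul_eq_mul,
    sigmaMinus_conjTranspose_opMul_self, diagonal_opMul, opMul_diagonal,
    opMul_sigmaMinus_conjTranspose_excited, if_true]
  ring

theorem dissipator_sigmaMinus_ground (m n : ℕ) :
    dissipator sigmaMinus ρ (m, 1) (n, 1) = ρ (m, 0) (n, 0) := by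
  simp [dissipator, sigmaMinus_conjTranspose_opMul_self, diagonal_opMul, opMul_diagonal,
    opMul_sigmaMinus_conjTranspose_ground, sigmaMinus_opMul_ground]

theorem dissipator_sigmaMinus_coherence (m n : ℕ) :
    dissipator sigmaMinus ρ (m, 0) (n, 1) = -(1 / 2) * ρ (m, 0) (n, 1) := by
  simp [dissipator, sigmaMinus_conjTranspose_opMul_self, diagonal_opMul, opMul_diagonal,
    opMul_sigmaMinus_conjTranspose_ground, sigmaMinus_opMul_excited]

variable {ρ} (κ γ : ℝ)

theorem lindbladian_excited (h : ρ.IsHermitian) (m : ℕ) :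
    (lindbladian ωc ωq g κ γ ρ (m, 0) (m, 0)).re =
      -(2 * g * (rung m * (ρ (m, 0) (m + 1, 1)).im)) - γ * (ρ (m, 0) (m, 0)).re
        + κ * (((m : ℝ) + 1) * (ρ (m + 1, 0) (m + 1, 0)).re - m * (ρ (m, 0) (m, 0)).re) := by
  have h1 : ρ (m + 1, 1) (m, 0) = star (ρ (m, 0) (m + 1, 1)) := (h.apply _ _).symm
  have h2 := rung_sq m
  simp only [lindbladian, Matrix.sub_apply, Matrix.add_apply, Matrix.smul_apply, smul_eq_mul,
    opMul_hamiltonian_eq, hamiltonian_opMul_excited, Matrix.transpose_apply, dissipator_opA,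
    dissipator_sigmaMinus_excited, h1]
  simp
  linear_combination κ * (ρ (m + 1, 0) (m + 1, 0)).re * h2

theorem lindbladian_ground (h : ρ.IsHermitian) (m : ℕ) :
    (lindbladian ωc ωq g κ γ ρ (m + 1, 1) (m + 1, 1)).re =
      2 * g * (rung m * (ρ (m, 0) (m + 1, 1)).im) + γ * (ρ (m + 1, 0) (m + 1, 0)).re
        + κ * (((m : ℝ) + 2) * (ρ (m + 1 + 1, 1) (m + 1 + 1, 1)).re
          - ((m : ℝ) + 1) * (ρ (m + 1, 1) (m + 1, 1)).re) := by
  have h1 : ρ (m + 1, 1) (m, 0) = star (ρ (m, 0) (m + 1, 1)) := (h.apply _ _).symm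
  have h2 := rung_sq (m + 1)
  push_cast at h2
  simp only [lindbladian, Matrix.sub_apply, Matrix.add_apply, Matrix.smul_apply, smul_eq_mul,
    opMul_hamiltonian_eq, hamiltonian_opMul_ground_succ, Matrix.transpose_apply, dissipator_opA,
    dissipator_sigmaMinus_ground, h1]
  simp
  linear_combination κ * (ρ (m + 1 + 1, 1) (m + 1 + 1, 1)).re * h2

/-- The two levels of a block differ in bare energy by ωq - ωc for every m, so a single detuning
governs all coherences. -/
theorem lindbladian_coherence (h : ρ.IsHermitian) (m : ℕ) :
    lindbladian ωc ωq g κ γ ρ (m, 0) (m + 1, 1) =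
      -Complex.I * (((ωq - ωc : ℝ) : ℂ) * ρ (m, 0) (m + 1, 1)
          + g * rung m * (((ρ (m + 1, 1) (m + 1, 1)).re - (ρ (m, 0) (m, 0)).re : ℝ) : ℂ))
        - γ * (((1 / 2 : ℝ) : ℂ) * ρ (m, 0) (m + 1, 1))
        + κ * (feed m * ρ (m + 1, 0) (m + 1 + 1, 1) - (((m : ℝ) + 1 / 2 : ℝ) : ℂ) * ρ (m, 0) (m + 1, 1))
        := by
  have h2 : ((ρ (m + 1, 1) (m + 1, 1)).re : ℂ) = ρ (m + 1, 1) (m + 1, 1) :=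
    h.coe_re_apply_self _
  have h3 : ((ρ (m, 0) (m, 0)).re : ℂ) = ρ (m, 0) (m, 0) := h.coe_re_apply_self _
  have h4 : (((ρ (m + 1, 1) (m + 1, 1)).re - (ρ (m, 0) (m, 0)).re : ℝ) : ℂ) =
      ρ (m + 1, 1) (m + 1, 1) - ρ (m, 0) (m, 0) := by rw [Complex.ofReal_sub]; exact congrArg₂ _ h2 h3
  rw [h4, feed_eq]
  simp only [lindbladian, Matrix.sub_apply, Matrix.add_apply, Matrix.smul_apply, smul_eq_mul,
    opMul_hamiltonian_eq, hamiltonian_opMul_excited, hamiltonian_opMul_ground_succ,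
    Matrix.transpose_apply, dissipator_opA, dissipator_sigmaMinus_coherence]
  push_cast
  ring

theorem lindbladian_vacuum :
    (lindbladian ωc ωq g κ γ ρ (0, 1) (0, 1)).re =
      κ * (ρ (1, 1) (1, 1)).re + γ * (ρ (0, 0) (0, 0)).re := by
  simp only [lindbladian, Matrix.sub_apply, Matrix.add_apply, Matrix.smul_apply, smul_eq_mul,
    opMul_hamiltonian_eq, hamiltonian_opMul_ground_zero, Matrix.transpose_apply, dissipator_opA,
    dissipator_sigmaMinus_ground]
  simp [rung]

end Generator

/-! ### From density operators to ladders -/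

/-- The block-diagonal part of a trajectory of operators. -/
def blockLadder (ρ : ℝ → Op) : Ladder where
  e m t := (ρ t (m, 0) (m, 0)).re
  q m t := (ρ t (m + 1, 1) (m + 1, 1)).re
  x m t := (ρ t (m, 0) (m + 1, 1)).re
  y m t := (ρ t (m, 0) (m + 1, 1)).im

theorem hasSum_prod_fin_two {E : Type*} [AddCommMonoid E] [TopologicalSpace E] [ContinuousAdd E]
    {F : Idx → E} {a b : E} (h0 : HasSum (fun n => F (n, 0)) a)
    (h1 : HasSum (fun n => F (n, 1)) b) : HasSum F (a + b) := by
  have hinj : ∀ s : Fin 2, Function.Injective fun n : ℕ => ((n, s) : Idx) := fun s n n' h =>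
    congrArg Prod.fst h
  have key : ∀ (s : Fin 2) (c : E), HasSum (fun n => F (n, s)) c →
      HasSum (fun x : Idx => if x.2 = s then F x else 0) c := fun s c h => by
    refine ((hinj s).hasSum_iff fun x hx => if_neg fun h2 => hx ⟨x.1, ?_⟩).1 ?_
    · rw [← h2]
    · simpa [Function.comp_def] using h
  convert (key 0 a h0).add (key 1 b h1) using 1
  funext ⟨n, s⟩
  fin_cases s <;> simp

namespace IsDensity

variable {ρ : Op} (h : IsDensity ρ)
include h

theorem diag_re_nonneg (x : Idx) : 0 ≤ (ρ x x).re := (Complex.le_def.1 h.posSemidef.diag_nonneg).1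

theorem ofReal_diag_re (x : Idx) : ((ρ x x).re : ℂ) = ρ x x :=
  h.posSemidef.isHermitian.coe_re_apply_self x

/-- Nonnegativity of the principal 2×2 minor on x and y. -/
theorem normSq_le (x y : Idx) : Complex.normSq (ρ x y) ≤ (ρ x x).re * (ρ y y).re := by
  have h1 := (h.posSemidef.submatrix ![x, y]).det_nonneg
  have h2 : ρ y x = star (ρ x y) := (h.posSemidef.isHermitian.apply _ _).symm
  rw [Matrix.det_fin_two] at h1
  simp only [Matrix.submatrix_apply, Matrix.cons_val_zero, Matrix.cons_val_one, h2,
    Complex.star_def, Complex.mul_conj] at h1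
  rw [← h.ofReal_diag_re x, ← h.ofReal_diag_re y] at h1
  have h3 : (0 : ℝ) ≤ (ρ x x).re * (ρ y y).re - Complex.normSq (ρ x y) := by exact_mod_cast h1
  linarith

theorem hasSum_diag_re : HasSum (fun x => (ρ x x).re) 1 := by
  simpa using Complex.hasSum_re h.hasSum_diag

end IsDensity

theorem IsDensity.summable_diag_re {ρ : Op} (h : IsDensity ρ) (s : Fin 2) :
    Summable fun n : ℕ => (ρ (n, s) (n, s)).re :=
  h.hasSum_diag_re.summable.comp_injective (i := fun n : ℕ => ((n, s) : Idx))
    fun _ _ hn => congrArg Prod.fst hn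

theorem IsDensity.hasSum_ground {ρ : Op} (h : IsDensity ρ) :
    HasSum (fun n : ℕ => (ρ (n, 1) (n, 1)).re) (1 - ∑' n : ℕ, (ρ (n, 0) (n, 0)).re) := by
  have h1 := (hasSum_prod_fin_two (F := fun x : Idx => (ρ x x).re) (h.summable_diag_re 0).hasSum
    (h.summable_diag_re 1).hasSum).unique h.hasSum_diag_re
  rw [← h1, add_sub_cancel_left]
  exact (h.summable_diag_re 1).hasSum

theorem IsDensity.hasSum_blocks {ρ : Op} (h : IsDensity ρ) :
    HasSum (fun m : ℕ => (ρ (m, 0) (m, 0)).re + (ρ (m + 1, 1) (m + 1, 1)).re)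
      (1 - (ρ (0, 1) (0, 1)).re) := by
  have h1 := (hasSum_nat_add_iff' 1).2 h.hasSum_ground
  convert (h.summable_diag_re 0).hasSum.add h1 using 1
  simp only [Finset.sum_range_one]
  ring

/-! ### Propagation of moments and the observed populations -/

namespace IsSolution

variable {ωc ωq g T : ℝ} {κ γ : ℝ → ℝ} {ρ₀ : Op} {ρ : ℝ → Op}
  (h : IsSolution ωc ωq g T κ γ ρ₀ ρ)
include h

theorem hasDeriv_re {t : ℝ} (ht : t ∈ Icc 0 T) (x y : Idx) :
    HasDerivWithinAt (fun s => (ρ s x y).re)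
      (lindbladian ωc ωq g (κ t) (γ t) (ρ t) x y).re (Icc 0 T) t :=
  Complex.reCLM.hasFDerivAt.comp_hasDerivWithinAt t (h.master t ht x y)

theorem hasDeriv_im {t : ℝ} (ht : t ∈ Icc 0 T) (x y : Idx) :
    HasDerivWithinAt (fun s => (ρ s x y).im)
      (lindbladian ωc ωq g (κ t) (γ t) (ρ t) x y).im (Icc 0 T) t :=
  Complex.imCLM.hasFDerivAt.comp_hasDerivWithinAt t (h.master t ht x y)

/-- The probability of at most `N` excitations changes only by the decay from the next block. -/
theorem hasDeriv_occupation (N : ℕ) {t : ℝ} (ht : t ∈ Icc 0 T) :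
    HasDerivWithinAt (fun s => (ρ s (0, 1) (0, 1)).re
        + ∑ k ∈ Finset.range N, ((blockLadder ρ).e k s + (blockLadder ρ).q k s))
      (κ t * (N * (blockLadder ρ).e N t + ((N : ℝ) + 1) * (blockLadder ρ).q N t)
        + γ t * (blockLadder ρ).e N t) (Icc 0 T) t := by
  have hH := (h.density t ht).posSemidef.isHermitian
  induction N with
  | zero =>
    simp only [Finset.range_zero, Finset.sum_empty, add_zero]
    refine (h.hasDeriv_re ht _ _).congr_deriv ?_
    rw [lindbladian_vacuum]
    simp [blockLadder]
  | succ N ih =>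
    simp only [Finset.sum_range_succ, ← add_assoc]
    have h1 := (h.hasDeriv_re ht (N, 0) (N, 0)).congr_deriv (lindbladian_excited _ _ _ _ _ hH N)
    have h2 := (h.hasDeriv_re ht (N + 1, 1) (N + 1, 1)).congr_deriv
      (lindbladian_ground _ _ _ _ _ hH N)
    refine (ih.add h1 |>.add h2).congr_deriv ?_
    simp only [blockLadder]
    push_cast
    ring

/-- The probability of at most M excitations never decreases. Block M holds M+1 excitations, so its
weight at time t is at most the initial probability of more than M. -/
theorem block_le_tail (hκ : IsRate T κ) (hγ : IsRate T γ) {t : ℝ} (ht : t ∈ Icc 0 T) (M : ℕ) :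
    (blockLadder ρ).e M t + (blockLadder ρ).q M t ≤
      ∑' k, ((blockLadder ρ).e (k + M) 0 + (blockLadder ρ).q (k + M) 0) := by
  have hnn : ∀ s ∈ Icc 0 T, ∀ k, 0 ≤ (blockLadder ρ).e k s + (blockLadder ρ).q k s :=
    fun s hs k => add_nonneg ((h.density s hs).diag_re_nonneg _) ((h.density s hs).diag_re_nonneg _)
  have hmono : MonotoneOn (fun s => (ρ s (0, 1) (0, 1)).re
      + ∑ k ∈ Finset.range M, ((blockLadder ρ).e k s + (blockLadder ρ).q k s)) (Icc 0 T) := by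
    refine monotoneOn_of_hasDerivWithinAt_nonneg (convex_Icc 0 T)
      (fun s hs => (h.hasDeriv_occupation M hs).continuousWithinAt)
      (fun s hs => (h.hasDeriv_occupation M (interior_subset hs)).mono interior_subset)
      fun s hs => ?_
    have hs' := interior_subset hs
    have he : 0 ≤ (blockLadder ρ).e M s := (h.density s hs').diag_re_nonneg _
    have hq : 0 ≤ (blockLadder ρ).q M s := (h.density s hs').diag_re_nonneg _
    have := hκ.2 s hs'
    have := hγ.2 s hs'
    positivity
  have h0 : (0 : ℝ) ∈ Icc 0 T := left_mem_Icc.2 (ht.1.trans ht.2)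
  have h1 := hmono h0 ht ht.1
  have h2 := sum_le_hasSum (Finset.range (M + 1)) (fun k _ => hnn t ht k)
    (h.density t ht).hasSum_blocks
  have h3 := ((h.density 0 h0).hasSum_blocks.summable.sum_add_tsum_nat_add M).trans
    (h.density 0 h0).hasSum_blocks.tsum_eq
  rw [Finset.sum_range_succ] at h2
  simp only [blockLadder] at h1 h2 h3 ⊢
  linarith

/-- The weights increase with the index, so (M+1)^k times the initial tail from M is at most the
full initial moment, independently of t and M. -/
theorem rapid_block (hmom : FiniteMoments ρ₀) (hκ : IsRate T κ) (hγ : IsRate T γ) :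
    Rapid T fun m t => (blockLadder ρ).e m t + (blockLadder ρ).q m t := fun k => by
  refine ⟨∑' m : ℕ, ((m : ℝ) + 1) ^ k * ((blockLadder ρ).e m 0 + (blockLadder ρ).q m 0),
    fun t ht M => ?_⟩
  have h0 : (0 : ℝ) ∈ Icc 0 T := left_mem_Icc.2 (ht.1.trans ht.2)
  have hnn : ∀ s ∈ Icc 0 T, ∀ k, 0 ≤ (blockLadder ρ).e k s + (blockLadder ρ).q k s :=
    fun s hs k => add_nonneg ((h.density s hs).diag_re_nonneg _) ((h.density s hs).diag_re_nonneg _)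
  have hsum : Summable fun m : ℕ =>
      ((m : ℝ) + 1) ^ k * ((blockLadder ρ).e m 0 + (blockLadder ρ).q m 0) := by
    have hd := h.density 0 h0
    rw [← h.initial] at hmom
    -- On the excited level (m+1)^k is bounded by 2^(k-1) (m^k + 1), hence the added zeroth moment.
    -- The ground state entry of block m already has m+1 photons.
    have he := ((hmom k).comp_injective (i := fun n : ℕ => ((n, 0) : Idx))
      fun _ _ hn => congrArg Prod.fst hn).add (hd.summable_diag_re 0)
    have hq := (hmom k).comp_injective (i := fun n : ℕ => ((n + 1, 1) : Idx))
      fun _ _ hn => Nat.succ_injective (congrArg Prod.fst hn)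
    have he' : Summable fun m : ℕ => ((m : ℝ) + 1) ^ k * (ρ 0 (m, 0) (m, 0)).re := by
      refine Summable.of_nonneg_of_le
        (fun m => mul_nonneg (by positivity) (hd.diag_re_nonneg _)) (fun m => ?_)
        (he.mul_left (2 ^ (k - 1)))
      refine (mul_le_mul_of_nonneg_right (add_pow_le (Nat.cast_nonneg m) zero_le_one k)
        (hd.diag_re_nonneg _)).trans (le_of_eq ?_)
      simp only [Function.comp_apply]
      ring
    refine (he'.add hq).congr fun m => ?_
    simp only [Function.comp_apply, blockLadder]
    push_cast
    ring
  rw [abs_of_nonneg (hnn t ht M)]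
  calc ((M : ℝ) + 1) ^ k * ((blockLadder ρ).e M t + (blockLadder ρ).q M t)
      ≤ ((M : ℝ) + 1) ^ k
          * ∑' m, ((blockLadder ρ).e (m + M) 0 + (blockLadder ρ).q (m + M) 0) := by
        gcongr
        exact h.block_le_tail hκ hγ ht M
    _ = ∑' m, ((M : ℝ) + 1) ^ k * ((blockLadder ρ).e (m + M) 0 + (blockLadder ρ).q (m + M) 0) :=
        tsum_mul_left.symm
    _ ≤ ∑' m : ℕ, (((m + M : ℕ) : ℝ) + 1) ^ k
          * ((blockLadder ρ).e (m + M) 0 + (blockLadder ρ).q (m + M) 0) := by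
        refine Summable.tsum_le_tsum (fun m => ?_)
          (((summable_nat_add_iff M).2 (h.density 0 h0).hasSum_blocks.summable).mul_left _)
          ((summable_nat_add_iff M).2 hsum)
        have := hnn 0 h0 (m + M)
        gcongr
        simp
    _ ≤ _ := by
        rw [← hsum.sum_add_tsum_nat_add M]
        exact le_add_of_nonneg_left
          (Finset.sum_nonneg fun m _ => mul_nonneg (by positivity) (hnn 0 h0 m))

theorem isEvolution_blockLadder (hmom : FiniteMoments ρ₀) (hκ : IsRate T κ) (hγ : IsRate T γ) :
    (blockLadder ρ).IsEvolution g (ωq - ωc) T κ γ where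
  deriv_e t ht m := (h.hasDeriv_re ht _ _).congr_deriv
    (lindbladian_excited _ _ _ _ _ (h.density t ht).posSemidef.isHermitian m)
  deriv_q t ht m := (h.hasDeriv_re ht _ _).congr_deriv
    (lindbladian_ground _ _ _ _ _ (h.density t ht).posSemidef.isHermitian m)
  deriv_x t ht m := (h.hasDeriv_re ht _ _).congr_deriv (by
    rw [lindbladian_coherence _ _ _ _ _ (h.density t ht).posSemidef.isHermitian]
    simp only [Complex.add_re, Complex.sub_re, Complex.neg_re, Complex.mul_re, Complex.neg_im,
      Complex.I_re, Complex.I_im, Complex.add_im, Complex.sub_im, Complex.mul_im,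
      Complex.ofReal_re, Complex.ofReal_im, blockLadder]
    ring)
  deriv_y t ht m := (h.hasDeriv_im ht _ _).congr_deriv (by
    rw [lindbladian_coherence _ _ _ _ _ (h.density t ht).posSemidef.isHermitian]
    simp only [Complex.add_re, Complex.sub_re, Complex.neg_re, Complex.mul_re, Complex.neg_im,
      Complex.I_re, Complex.I_im, Complex.add_im, Complex.sub_im, Complex.mul_im,
      Complex.ofReal_re, Complex.ofReal_im, blockLadder]
    ring)
  e_nonneg t ht m := (h.density t ht).diag_re_nonneg _
  q_nonneg t ht m := (h.density t ht).diag_re_nonneg _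
  coherence t ht m := by
    have := (h.density t ht).normSq_le (m, 0) (m + 1, 1)
    rw [Complex.normSq_apply] at this
    simp only [blockLadder]
    linarith
  rapid_e := (h.rapid_block hmom hκ hγ).of_abs_le fun t ht m => by
    have he : 0 ≤ (blockLadder ρ).e m t := (h.density t ht).diag_re_nonneg _
    have hq : 0 ≤ (blockLadder ρ).q m t := (h.density t ht).diag_re_nonneg _
    rw [abs_of_nonneg he, abs_of_nonneg (add_nonneg he hq)]
    exact le_add_of_nonneg_right hq
  rapid_q := (h.rapid_block hmom hκ hγ).of_abs_le fun t ht m => by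
    have he : 0 ≤ (blockLadder ρ).e m t := (h.density t ht).diag_re_nonneg _
    have hq : 0 ≤ (blockLadder ρ).q m t := (h.density t ht).diag_re_nonneg _
    rw [abs_of_nonneg hq, abs_of_nonneg (add_nonneg he hq)]
    exact le_add_of_nonneg_left he

theorem expect_sigmaZ {t : ℝ} (ht : t ∈ Icc 0 T) :
    expect sigmaZ (ρ t) = ((2 * (blockLadder ρ).exc t - 1 : ℝ) : ℂ) := by
  have hd := h.density t ht
  have h1 : HasSum (fun x : Idx => (if x.2 = 0 then (1 : ℝ) else -1) * (ρ t x x).re)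
      ((blockLadder ρ).exc t + -(1 - (blockLadder ρ).exc t)) :=
    hasSum_prod_fin_two (by simpa [Ladder.exc, blockLadder] using (hd.summable_diag_re 0).hasSum)
      (by simpa [Ladder.exc, blockLadder] using hd.hasSum_ground.neg)
  rw [show 2 * (blockLadder ρ).exc t - 1
    = (blockLadder ρ).exc t + -(1 - (blockLadder ρ).exc t) by ring]
  refine Eq.trans (tsum_congr fun x => ?_) (Complex.hasSum_ofReal.2 h1).tsum_eq
  rw [sigmaZ_eq, diagonal_opMul, ← hd.ofReal_diag_re x]
  push_cast
  split_ifs <;> simp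

theorem expect_opN (hmom : FiniteMoments ρ₀) (hκ : IsRate T κ) (hγ : IsRate T γ) {t : ℝ}
    (ht : t ∈ Icc 0 T) : expect opN (ρ t) = ((blockLadder ρ).phot t : ℂ) := by
  have hd := h.density t ht
  have hev := h.isEvolution_blockLadder hmom hκ hγ
  have he := ((hev.rapid_e.coeff_mul Tempered.natCast).summable ht).hasSum
  have hq := ((hev.rapid_q.coeff_mul Tempered.succ).summable ht).hasSum
  have h1 : HasSum (fun x : Idx => (x.1 : ℝ) * (ρ t x x).re)
      (∑' m : ℕ, (m : ℝ) * (blockLadder ρ).e m t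
        + ∑' m : ℕ, ((m : ℝ) + 1) * (blockLadder ρ).q m t) := by
    refine hasSum_prod_fin_two he ((hasSum_nat_add_iff' 1).1 ?_)
    simpa [blockLadder] using hq
  have h2 : (blockLadder ρ).phot t = ∑' m : ℕ, (m : ℝ) * (blockLadder ρ).e m t
      + ∑' m : ℕ, ((m : ℝ) + 1) * (blockLadder ρ).q m t := by
    rw [add_comm]
    exact (hq.add he).tsum_eq
  rw [h2]
  refine Eq.trans (tsum_congr fun x => ?_) (Complex.hasSum_ofReal.2 h1).tsum_eq
  rw [opN_eq, diagonal_opMul, ← hd.ofReal_diag_re x]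
  push_cast
  simp

/-- Only the vacuum with the qubit in its ground state carries no excitation. -/
theorem exc_add_phot_pos (hT : 0 ≤ T) (hmom : FiniteMoments ρ₀) (hκ : IsRate T κ)
    (hγ : IsRate T γ) (hvac : ρ₀ ≠ vacuumGround) :
    0 < (blockLadder ρ).exc 0 + (blockLadder ρ).phot 0 := by
  have h0 : (0 : ℝ) ∈ Icc 0 T := left_mem_Icc.2 hT
  have hev := h.isEvolution_blockLadder hmom hκ hγ
  have hd := h.density 0 h0
  have hp := hev.exc_nonneg h0
  have hn := hev.phot_nonneg h0
  by_contra hneg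
  have he := hev.e_eq_zero_of_exc h0 (by linarith)
  have hq := fun m => (hev.eq_zero_of_phot h0 (by linarith) m).1
  have hdiag : ∀ x : Idx, x ≠ (0, 1) → (ρ 0 x x).re = 0 := by
    rintro ⟨m, s⟩ hx
    fin_cases s
    · exact he m
    · rcases m with _ | m
      · exact absurd rfl hx
      · exact hq m
  -- By positivity a vanishing diagonal entry kills its whole row and column, so only the vacuum
  -- entry survives.
  have hoff : ∀ x y : Idx, (ρ 0 x x).re * (ρ 0 y y).re = 0 → ρ 0 x y = 0 := fun x y hxy =>
    Complex.normSq_eq_zero.1 (le_antisymm ((hd.normSq_le x y).trans_eq hxy) (Complex.normSq_nonneg _))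
  have hone : (ρ 0 (0, 1) (0, 1)).re = 1 :=
    (hasSum_single (0, 1) hdiag).unique hd.hasSum_diag_re
  refine hvac ?_
  rw [← h.initial]
  ext x y
  by_cases hx : x = (0, 1)
  · by_cases hy : y = (0, 1)
    · subst hx hy
      rw [← hd.ofReal_diag_re, hone]
      simp [vacuumGround]
    · rw [hoff x y (by rw [hdiag y hy, mul_zero]), vacuumGround,
        Matrix.single_apply_of_ne _ _ _ _ _ (fun hxy => hy hxy.2.symm)]
  · rw [hoff x y (by rw [hdiag x hx, zero_mul]), vacuumGround,
      Matrix.single_apply_of_ne _ _ _ _ _ (fun hxy => hx hxy.1.symm)]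

end IsSolution

end JaynesCummings

/-! ### Conclusion: populations read off the observables -/

theorem mainTheorem3
    (ωc ωq g T : ℝ) (hT : 0 < T)
    (ρ₀ : JaynesCummings.Op)
    (hmom : JaynesCummings.FiniteMoments ρ₀)
    (hvac : ρ₀ ≠ JaynesCummings.vacuumGround)
    (hdec : g = 0 → JaynesCummings.expect JaynesCummings.opN ρ₀ ≠ 0 ∧
      JaynesCummings.expect JaynesCummings.sigmaZ ρ₀ ≠ -1)
    (κ₁ γ₁ κ₂ γ₂ : ℝ → ℝ)
    (hκ₁ : JaynesCummings.IsRate T κ₁) (hγ₁ : JaynesCummings.IsRate T γ₁)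
    (hκ₂ : JaynesCummings.IsRate T κ₂) (hγ₂ : JaynesCummings.IsRate T γ₂)
    (ρ₁ ρ₂ : ℝ → JaynesCummings.Op)
    (hρ₁ : JaynesCummings.IsSolution ωc ωq g T κ₁ γ₁ ρ₀ ρ₁)
    (hρ₂ : JaynesCummings.IsSolution ωc ωq g T κ₂ γ₂ ρ₀ ρ₂)
    (hobs : ∀ O ∈ ({JaynesCummings.sigmaX, JaynesCummings.sigmaY, JaynesCummings.sigmaZ,
        JaynesCummings.opN, JaynesCummings.opXZ} : Set JaynesCummings.Op),
      ∀ t ∈ Set.Icc 0 T,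
        JaynesCummings.expect O (ρ₁ t) = JaynesCummings.expect O (ρ₂ t)) :
    ∀ t ∈ Set.Icc 0 T, γ₁ t = γ₂ t ∧ κ₁ t = κ₂ t := by
  have hu := hρ₁.isEvolution_blockLadder hmom hκ₁ hγ₁
  have hv := hρ₂.isEvolution_blockLadder hmom hκ₂ hγ₂
  have h0 : (0 : ℝ) ∈ Set.Icc 0 T := Set.left_mem_Icc.2 hT.le
  have hexc : ∀ t ∈ Set.Icc 0 T, (JaynesCummings.blockLadder ρ₁).exc t
      = (JaynesCummings.blockLadder ρ₂).exc t := fun t ht => by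
    have h1 := hobs JaynesCummings.sigmaZ (by simp) t ht
    rw [hρ₁.expect_sigmaZ ht, hρ₂.expect_sigmaZ ht, Complex.ofReal_inj] at h1
    linarith
  have hphot : ∀ t ∈ Set.Icc 0 T, (JaynesCummings.blockLadder ρ₁).phot t
      = (JaynesCummings.blockLadder ρ₂).phot t := fun t ht => by
    have h1 := hobs JaynesCummings.opN (by simp) t ht
    rwa [hρ₁.expect_opN hmom hκ₁ hγ₁ ht, hρ₂.expect_opN hmom hκ₂ hγ₂ ht,
      Complex.ofReal_inj] at h1
  by_cases hg : g = 0
  · obtain ⟨hn, hp⟩ := hdec hg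
    rw [← hρ₂.initial, hρ₂.expect_opN hmom hκ₂ hγ₂ h0] at hn
    rw [← hρ₂.initial, hρ₂.expect_sigmaZ h0] at hp
    refine hu.rates_eq_of_uncoupled hv hκ₁ hγ₁ hκ₂ hγ₂ hexc hphot hg hT
      (lt_of_le_of_ne (hv.exc_nonneg h0) fun h => hp ?_)
      (lt_of_le_of_ne (hv.phot_nonneg h0) fun h => hn ?_)
    · rw [← h]; simp
    · rw [← h]; simp
  · refine hu.rates_eq_of_coupled hv hκ₁ hγ₁ hκ₂ hγ₂ hexc hphot hg hT
      (hρ₂.exc_add_phot_pos hT.le hmom hκ₂ hγ₂ hvac) fun m => ?_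
    simp [JaynesCummings.blockLadder, hρ₁.initial, hρ₂.initial]
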